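/- All vector spaces are real and all compact spaces are Hausdorff. For a normed space $E$ and $A\subseteq E$ let $A^{\circ\circ}=\{x\in E : |\varphi(x)|\le 1 \text{ for every } \varphi\in E^*\text{ with } |\varphi|\le 1 \text{ on } A\}$, and let $B_E$ be the closed unit ball. A bornological class $\mathfrak B$ assigns to every compact space $K$ a family $\mathfrak B_K$ of norm bounded subsets of $C(K)$ such that: (i) $\mathfrak B_K$ covers $C(K)$ and is closed under subsets, finite unions, sums $A+A'$, scalar multiples, balanced hulls $\{cx: x\in A,\ |c|\le 1\}$ and convex hulls, and contains no nonzero linear subspace; (ii) for continuous $p\colon K_1\to K_2$, $A\in\mathfrak B_{K_2}$ implies $A\circ p\in\mathfrak B_{K_1}$, and the converse holds if $p$ is surjective; (iii) $A\in\mathfrak B_K$ implies $A^{\circ\circ}\in\mathfrak B_K$. It is polarly compatible if, whenever $A\in\mathfrak B_K$, the family $\{\varphi\mapsto\varphi(f) : f\in A\}$ of functions on the weak-star compact ball $B_{C(K)^*}$ belongs to $\mathfrak B_{B_{C(K)^*}}$. For a Banach space $E$, a set $M\subseteq E^*$ is co-$\mathfrak B$-small if it is norm bounded and, for every bounded $A\subseteq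 E$, the family of functions $\varphi\mapsto\varphi(x)$, $x\in A$, on the weak-star closure $\overline M^{w^*}$ belongs to $\mathfrak B_{\overline M^{w^*}}$; this definition applies to any assignment $K\mapsto\mathfrak B_K$ of a family of subsets of $C(K)$ to every compact space. Let $G$ be a locally compact Hausdorff group with left Haar measure, let $L^1(G)$ be its convolution algebra, $(a\star b)(g)=\int_G a(h)b(h^{-1}g)\,dh$, and identify $L^\infty(G)$ with $L^1(G)^*$ via $\langle a,\varphi\rangle=\int_G a\varphi$. For $\varphi\in L^1(G)^*$ and $a\in L^1(G)$ put $(\varphi\cdot a)(b)=\varphi(a\star b)$; let $\mathrm{ruc}(L^1(G))$ be the closed linear span of $\{\varphi\cdot a\}$. For a function $f$ on $G$ put $(f\cdot g)(x)=f(gx)$, and let $\mathrm{RUC}(G)$ be the set of bounded functions on $G$ that are uniformly continuous for the right uniformity, with basic entourages $\{(x,y): xy^{-1}\in U\}$, $U$ a neighbourhood of the identity. For every polarly compatible bornological class $\mathfrak B$, the following two subsets of $L^\infty(G)=L^1(G)^*$ are equal: \[ \{\varphi\in \mathrm{ruc}(L^1(G)) : \varphi\cdot B_{L^1(G)} \text{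 is co-}\mathfrak B\text{-small}\} =\{f\in \mathrm{RUC}(G) : f\cdot G \text{ is co-}\mathfrak B\text{-small}\}. \] That is, the co-$\mathfrak B$-small functionals on $L^1(G)$ are exactly the co-$\mathfrak B$-small functions on $G$. In particular, this equality holds when $\mathfrak B$ is 1. $[\mathrm{DLP}]$: bounded families $F\subseteq C(K)$ such that for all sequences $(f_n)$ in $F$ and $(x_m)$ in $K$ the limits $\lim_n\lim_m f_n(x_m)$ and $\lim_m\lim_n f_n(x_m)$ are equal whenever both exist; 2. $[\mathrm{NP}]$: bounded fragmented families $F\subseteq C(K)$, i.e. for every nonempty $S\subseteq K$ and every $\varepsilon>0$ there is an open $O\subseteq K$ with $O\cap S\neq\emptyset$ and $|f(x)-f(y)|<\varepsilon$ for all $f\in F$ and $x,y\in O\cap S$; 3. $[\mathrm T]$: bounded tame families $F\subseteq C(K)$, i.e. there are no sequence $(f_n)$ in $F$ and reals $a<b$ such that for all finite disjoint $P,M\subseteq\mathbb N$ some $x\in K$ satisfies $f_n(x)<a$ for $n\in P$ and $f_n(x)>b$ for $n\in M$. -/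

import Mathlib

open MeasureTheory Filter Topology
open scoped Pointwise BoundedContinuousFunction

universe u

noncomputable section

set_option linter.unusedSectionVars false

/-! ### Bornological classes -/

/-- An assignment `K ↦ 𝔅_K` of a family of subsets of `C(K)` to every compact (Hausdorff)
space `K`. -/
abbrev FamilyClass : Type (u + 1) :=
  ∀ (K : Type u) [TopologicalSpace K] [CompactSpace K] [T2Space K], Set (Set C(K, ℝ))

/-- Separated convex vector bornologies on a real vector space `E`. -/
structure IsSeparatedConvexVectorBornology {E : Type*} [AddCommGroup E] [Module ℝ E]
    (B : Set (Set E)) : Prop where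
  covers : ⋃₀ B = Set.univ
  subset : ∀ A ∈ B, ∀ A' ⊆ A, A' ∈ B
  union : ∀ A ∈ B, ∀ A' ∈ B, A ∪ A' ∈ B
  add : ∀ A ∈ B, ∀ A' ∈ B, A + A' ∈ B
  smul : ∀ A ∈ B, ∀ c : ℝ, c • A ∈ B
  bal : ∀ A ∈ B, {y : E | ∃ x ∈ A, ∃ c ∈ Set.Icc (-1 : ℝ) 1, y = c • x} ∈ B
  convex : ∀ A ∈ B, convexHull ℝ A ∈ B
  separated : ∀ S : Submodule ℝ E, (S : Set E) ∈ B → S = ⊥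

/-- The bipolar `A°°` of a subset of a normed space `E`, with respect to the dual of `E`. -/
def bipolar {E : Type*} [NormedAddCommGroup E] [NormedSpace ℝ E] (A : Set E) : Set E :=
  {x | ∀ φ : StrongDual ℝ E, (∀ y ∈ A, |φ y| ≤ 1) → |φ x| ≤ 1}

/-- Bornological classes. -/
structure IsBornologicalClass (𝔅 : FamilyClass.{u}) : Prop where
  bornology : ∀ (K : Type u) [TopologicalSpace K] [CompactSpace K] [T2Space K],
    IsSeparatedConvexVectorBornology (𝔅 K)
  bounded : ∀ (K : Type u) [TopologicalSpace K] [CompactSpace K] [T2Space K],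
    ∀ A ∈ 𝔅 K, Bornology.IsBounded A
  comp : ∀ (K₁ K₂ : Type u) [TopologicalSpace K₁] [CompactSpace K₁] [T2Space K₁]
    [TopologicalSpace K₂] [CompactSpace K₂] [T2Space K₂] (p : C(K₁, K₂)) (A : Set C(K₂, ℝ)),
    A ∈ 𝔅 K₂ → (fun f : C(K₂, ℝ) => f.comp p) '' A ∈ 𝔅 K₁
  of_comp : ∀ (K₁ K₂ : Type u) [TopologicalSpace K₁] [CompactSpace K₁] [T2Space K₁]
    [TopologicalSpace K₂] [CompactSpace K₂] [T2Space K₂] (p : C(K₁, K₂)) (A : Set C(K₂, ℝ)),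
    Function.Surjective p → (fun f : C(K₂, ℝ) => f.comp p) '' A ∈ 𝔅 K₁ → A ∈ 𝔅 K₂
  bipolar : ∀ (K : Type u) [TopologicalSpace K] [CompactSpace K] [T2Space K],
    ∀ A ∈ 𝔅 K, bipolar A ∈ 𝔅 K

section WeakStar

variable {E : Type u} [NormedAddCommGroup E] [NormedSpace ℝ E]

/-- The restriction operator `r : E → C(M)`, `r(x)(φ) = φ(x)`, for a set `M` of functionals,
equipped with the weak-star topology. -/
def restr (M : Set (WeakDual ℝ E)) (x : E) : C(M, ℝ) :=
  ⟨fun φ => (φ : WeakDual ℝ E) x, (WeakDual.eval_continuous x).comp continuous_subtype_val⟩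

/-- The closed unit ball of the dual of `E`, with the weak-star topology. -/
def dualBall (E : Type u) [NormedAddCommGroup E] [NormedSpace ℝ E] : Set (WeakDual ℝ E) :=
  WeakDual.toStrongDual ⁻¹' Metric.closedBall 0 1

instance compactSpace_dualBall : CompactSpace (dualBall E) :=
  isCompact_iff_compactSpace.mp (WeakDual.isCompact_closedBall 0 1)

/-- The weak-star closure of a set of functionals, with the weak-star topology. -/
def wsClosure (M : Set (StrongDual ℝ E)) : Set (WeakDual ℝ E) :=
  closure (StrongDual.toWeakDual '' M)

theorem compactSpace_wsClosure {M : Set (StrongDual ℝ E)} (hM : Bornology.IsBounded M) :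
    CompactSpace (wsClosure M) := by
  obtain ⟨R, hR⟩ := hM.subset_closedBall 0
  refine isCompact_iff_compactSpace.mp
    ((WeakDual.isCompact_closedBall (0 : StrongDual ℝ E) R).of_isClosed_subset isClosed_closure
      (closure_minimal ?_ (WeakDual.isClosed_closedBall 0 R)))
  rintro _ ⟨φ, hφ, rfl⟩
  exact hR hφ

/-- `M ⊆ E*` is co-`𝔅`-small with respect to `A ⊆ E`: it is equicontinuous, i.e. norm bounded,
and `r(A)` belongs to `𝔅` on the (compact) weak-star closure of `M`. -/
def IsCoSmallWrt (𝔅 : FamilyClass.{u}) (A : Set E) (M : Set (StrongDual ℝ E)) : Prop :=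
  ∃ hM : Bornology.IsBounded M,
    haveI := compactSpace_wsClosure hM
    restr (wsClosure M) '' A ∈ 𝔅 (wsClosure M)

/-- `M ⊆ E*` is co-`𝔅`-small: it is so with respect to every bounded subset of `E`. -/
def IsCoSmall (𝔅 : FamilyClass.{u}) (M : Set (StrongDual ℝ E)) : Prop :=
  ∀ A : Set E, Bornology.IsBounded A → IsCoSmallWrt 𝔅 A M

end WeakStar

/-- Polar compatibility: if `A ∈ 𝔅_K`, then `A`, seen as a family of functions on the weak-star
compact unit ball `B` of `C(K)*`, belongs to `𝔅_B`. -/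
def IsPolarlyCompatible (𝔅 : FamilyClass.{u}) : Prop :=
  ∀ (K : Type u) [TopologicalSpace K] [CompactSpace K] [T2Space K], ∀ A ∈ 𝔅 K,
    restr (dualBall C(K, ℝ)) '' A ∈ 𝔅 (dualBall C(K, ℝ))

/-! ### The classes [DLP], [NP] and [T] -/

/-- Grothendieck's double limit property of a family of real functions on a set. -/
def HasDLP {X : Type*} (F : Set (X → ℝ)) : Prop :=
  ∀ (f : ℕ → X → ℝ) (x : ℕ → X), (∀ n, f n ∈ F) →
    ∀ (p q : ℕ → ℝ) (s t : ℝ),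
      (∀ n, Tendsto (fun m => f n (x m)) atTop (𝓝 (p n))) → Tendsto p atTop (𝓝 s) →
      (∀ m, Tendsto (fun n => f n (x m)) atTop (𝓝 (q m))) → Tendsto q atTop (𝓝 t) →
      s = t

/-- Fragmented families of real functions on a topological space. -/
def IsFragmentedFamily {X : Type*} [TopologicalSpace X] (F : Set (X → ℝ)) : Prop :=
  ∀ S : Set X, S.Nonempty → ∀ ε > 0, ∃ O : Set X, IsOpen O ∧ (O ∩ S).Nonempty ∧
    ∀ f ∈ F, ∀ x ∈ O ∩ S, ∀ y ∈ O ∩ S, |f x - f y| < ε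

/-- (Combinatorially) independent sequences of real functions on a set. -/
def IsIndependentSeq {X : Type*} (f : ℕ → X → ℝ) : Prop :=
  ∃ a b : ℝ, a < b ∧ ∀ P M : Finset ℕ, Disjoint P M →
    ∃ x : X, (∀ n ∈ P, f n x < a) ∧ (∀ n ∈ M, b < f n x)

/-- The class **[DLP]** of bounded families with the double limit property. -/
def dlpClass : FamilyClass.{u} := fun K _ _ _ =>
  {A | Bornology.IsBounded A ∧ HasDLP ((fun f : C(K, ℝ) => (f : K → ℝ)) '' A)}

/-- The class **[NP]** of bounded fragmented families. -/
def npClass : FamilyClass.{u} := fun K _ _ _ =>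
  {A | Bornology.IsBounded A ∧ IsFragmentedFamily ((fun f : C(K, ℝ) => (f : K → ℝ)) '' A)}

/-- The class **[T]** of tame families: bounded families without independent sequences. -/
def tameClass : FamilyClass.{u} := fun K _ _ _ =>
  {A | Bornology.IsBounded A ∧
    ∀ f : ℕ → C(K, ℝ), (∀ n, f n ∈ A) → ¬ IsIndependentSeq (fun n => (f n : K → ℝ))}

/-! ### Functionals on Banach algebras

The product of the algebra `𝒜` is given as a continuous bilinear map `m`. -/

section Functionals

variable {𝒜 : Type u} [NormedAddCommGroup 𝒜] [NormedSpace ℝ 𝒜]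

/-- The right action of `𝒜` on its dual: `(φ · a)(b) = φ(ab)`. -/
def dualAct (m : 𝒜 →L[ℝ] 𝒜 →L[ℝ] 𝒜) (φ : StrongDual ℝ 𝒜) (a : 𝒜) : StrongDual ℝ 𝒜 :=
  φ.comp (m a)

/-- `ruc(𝒜)`: the closed linear span of `𝒜* · 𝒜`. -/
def ruc (m : 𝒜 →L[ℝ] 𝒜 →L[ℝ] 𝒜) : Submodule ℝ (StrongDual ℝ 𝒜) :=
  (Submodule.span ℝ {ψ | ∃ φ a, ψ = dualAct m φ a}).topologicalClosure

/-- The (right) co-`𝔅`-small functionals: those `φ ∈ ruc(𝒜)` for which the set `φ · B_𝒜` is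
co-`𝔅`-small in the dual of `𝒜`, where `B_𝒜` is the closed unit ball. -/
def coSmallFunctionals (m : 𝒜 →L[ℝ] 𝒜 →L[ℝ] 𝒜) (𝔅 : FamilyClass.{u}) :
    Set (StrongDual ℝ 𝒜) :=
  {φ | φ ∈ ruc m ∧ IsCoSmall 𝔅 (dualAct m φ '' Metric.closedBall 0 1)}

end Functionals

/-! ### The group algebra -/

section GroupAlgebra

variable {G : Type u} [Group G] [TopologicalSpace G] [IsTopologicalGroup G]
  [LocallyCompactSpace G] [MeasurableSpace G] [BorelSpace G]
  (μ : Measure G) [μ.IsHaarMeasure] [μ.Regular]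

/-- The left translate `(h · b)(g) = b(h⁻¹g)` of `b ∈ L¹(G)`. -/
def leftTranslate (h : G) (b : Lp ℝ 1 μ) : Lp ℝ 1 μ :=
  Lp.compMeasurePreserving (h⁻¹ * ·) (measurePreserving_mul_left μ h⁻¹) b

theorem norm_leftTranslate (h : G) (b : Lp ℝ 1 μ) : ‖leftTranslate μ h b‖ = ‖b‖ :=
  Lp.norm_compMeasurePreserving _ _

theorem continuous_leftTranslate (b : Lp ℝ 1 μ) :
    Continuous (fun h : G => leftTranslate μ h b) := by
  have : Fact ((1 : ENNReal) ≠ ⊤) := ⟨ENNReal.one_ne_top⟩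
  have h1 : Continuous (fun h : G => DomMulAct.mk h⁻¹ • b) :=
    (DomMulAct.continuous_mk.comp continuous_inv).smul continuous_const
  exact h1

theorem aestronglyMeasurable_smul_continuous {F : G → Lp ℝ 1 μ} (hF : Continuous F)
    {a : G → ℝ} (ha : Integrable a μ) : AEStronglyMeasurable (fun h => a h • F h) μ := by
  refine Integrable.induction (P := fun a => AEStronglyMeasurable (fun h => a h • F h) μ)
    ?_ ?_ ?_ ?_ ha
  · intro c s hs hμs
    have h1 : (fun h => s.indicator (fun _ => c) h • F h) = s.indicator (fun h => c • F h) := by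
      ext1 h
      by_cases hh : h ∈ s <;> simp [hh]
    rw [h1, aestronglyMeasurable_indicator_iff hs]
    have h2 : ∀ n : ℕ, ∃ K ⊆ s, IsCompact K ∧ IsClosed K ∧ μ (s \ K) < ((n : ENNReal) + 1)⁻¹ :=
      fun n => hs.exists_isCompact_isClosed_sdiff_lt hμs.ne (by simp)
    choose K hKs hKc hKcl hK using h2
    have h3 : (⋃ n, K n : Set G) =ᵐ[μ] s := by
      refine (ae_eq_set (μ := μ)).mpr
        ⟨by simp [Set.sdiff_eq_empty.mpr (Set.iUnion_subset hKs)], ?_⟩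
      refine le_antisymm (ge_of_tendsto' (f := fun n : ℕ => ((n : ENNReal) + 1)⁻¹) (x := atTop)
        ?_ fun n => (measure_mono (Set.sdiff_subset_sdiff_right
          (Set.subset_iUnion K n))).trans (hK n).le) zero_le
      simpa using (tendsto_add_atTop_iff_nat 1).mpr ENNReal.tendsto_inv_nat_nhds_zero
    rw [← Measure.restrict_congr_set h3]
    refine (aestronglyMeasurable_iUnion_iff).mpr fun n => ?_
    exact (hF.const_smul c).continuousOn.aestronglyMeasurable_of_isCompact (hKc n)
      (hKcl n).measurableSet
  · intro f g _ _ _ hf hg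
    simp only [Pi.add_apply, add_smul]
    exact hf.add hg
  · refine IsSeqClosed.isClosed fun f f' hf hff' => ?_
    obtain ⟨ns, -, hns⟩ := (tendstoInMeasure_of_tendsto_Lp hff').exists_seq_tendsto_ae
    refine aestronglyMeasurable_of_tendsto_ae atTop (fun i => hf (ns i)) ?_
    filter_upwards [hns] with h hh using hh.smul_const _
  · intro f g hfg _ hf
    refine hf.congr ?_
    filter_upwards [hfg] with h hh
    rw [hh]

theorem integrable_conv (a b : Lp ℝ 1 μ) :
    Integrable (fun h => a h • leftTranslate μ h b) μ := by
  have ha : Integrable a μ := L1.integrable_coeFn a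
  refine (ha.norm.mul_const ‖b‖).mono'
    (aestronglyMeasurable_smul_continuous μ (continuous_leftTranslate μ b) ha)
    (ae_of_all _ fun h => ?_)
  rw [norm_smul, norm_leftTranslate]

/-- The convolution of `L¹(G)` as a continuous bilinear map: `a ⋆ b` is the `L¹(G)`-valued
integral `∫ a(h) (h · b) dh`, that is, `(a ⋆ b)(g) = ∫ a(h) b(h⁻¹g) dh`. -/
def l1Conv : Lp ℝ 1 μ →L[ℝ] Lp ℝ 1 μ →L[ℝ] Lp ℝ 1 μ :=
  LinearMap.mkContinuous₂
    (LinearMap.mk₂ ℝ (fun a b => ∫ h, a h • leftTranslate μ h b ∂μ)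
      (fun a a' b => by
        rw [← integral_add (integrable_conv μ a b) (integrable_conv μ a' b)]
        refine integral_congr_ae ?_
        filter_upwards [Lp.coeFn_add a a'] with h hh
        rw [hh, Pi.add_apply, add_smul])
      (fun c a b => by
        rw [← integral_smul]
        refine integral_congr_ae ?_
        filter_upwards [Lp.coeFn_smul c a] with h hh
        rw [hh, Pi.smul_apply, smul_assoc])
      (fun a b b' => by
        rw [← integral_add (integrable_conv μ a b) (integrable_conv μ a b')]
        refine integral_congr_ae (ae_of_all _ fun h => ?_)
        simp only [leftTranslate, map_add, smul_add])
      (fun c a b => by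
        rw [← integral_smul]
        refine integral_congr_ae (ae_of_all _ fun h => ?_)
        have : leftTranslate μ h (c • b) = c • leftTranslate μ h b :=
          smul_comm (DomMulAct.mk h⁻¹) c b
        beta_reduce
        rw [this, smul_comm])) 1
    (fun a b => by
      refine (norm_integral_le_integral_norm _).trans (le_of_eq ?_)
      simp only [norm_smul, norm_leftTranslate]
      rw [integral_mul_const, one_mul, ← L1.norm_eq_integral_norm a])

theorem l1Conv_apply (a b : Lp ℝ 1 μ) : l1Conv μ a b = ∫ h, a h • leftTranslate μ h b ∂μ := rfl

theorem integrable_mul_bounded (f : G →ᵇ ℝ) (a : Lp ℝ 1 μ) :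
    Integrable (fun g => a g * f g) μ :=
  (L1.integrable_coeFn a).mul_bdd (c := ‖f‖) f.continuous.aestronglyMeasurable
    (ae_of_all _ f.norm_coe_le_norm)

/-- A bounded continuous function `f` on `G` as an element of `L^∞(G) = L¹(G)*`:
the functional `a ↦ ∫ a(g) f(g) dg`. -/
def toFunctional (f : G →ᵇ ℝ) : StrongDual ℝ (Lp ℝ 1 μ) :=
  LinearMap.mkContinuous
    { toFun := fun a => ∫ g, a g * f g ∂μ
      map_add' := fun a a' => by
        rw [← integral_add (integrable_mul_bounded μ f a) (integrable_mul_bounded μ f a')]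
        refine integral_congr_ae ?_
        filter_upwards [Lp.coeFn_add a a'] with g hg
        rw [hg, Pi.add_apply, add_mul]
      map_smul' := fun c a => by
        rw [RingHom.id_apply, ← integral_smul]
        refine integral_congr_ae ?_
        filter_upwards [Lp.coeFn_smul c a] with g hg
        rw [hg, Pi.smul_apply, smul_mul_assoc] } ‖f‖
    (fun a => by
      refine (norm_integral_le_of_norm_le ((L1.integrable_coeFn a).norm.mul_const ‖f‖)
        (ae_of_all _ fun g => ?_)).trans (le_of_eq ?_)
      · rw [norm_mul]
        exact mul_le_mul_of_nonneg_left (f.norm_coe_le_norm g) (norm_nonneg _)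
      · rw [integral_mul_const, mul_comm, ← L1.norm_eq_integral_norm a])

theorem toFunctional_apply (f : G →ᵇ ℝ) (a : Lp ℝ 1 μ) :
    toFunctional μ f a = ∫ g, a g * f g ∂μ := rfl

/-- The pairing of a convolution with a bounded continuous function `f`:
`⟨a ⋆ b, f⟩ = ∫ a(h) ∫ b(h⁻¹g) f(g) dg dh`. -/
theorem toFunctional_l1Conv (f : G →ᵇ ℝ) (a b : Lp ℝ 1 μ) :
    toFunctional μ f (l1Conv μ a b) = ∫ h, a h * ∫ g, b (h⁻¹ * g) * f g ∂μ ∂μ := by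
  rw [l1Conv_apply, ← ContinuousLinearMap.integral_comp_comm _ (integrable_conv μ a b)]
  refine integral_congr_ae (ae_of_all _ fun h => ?_)
  beta_reduce
  rw [map_smul, smul_eq_mul, toFunctional_apply]
  congr 1
  refine integral_congr_ae ?_
  filter_upwards [Lp.coeFn_compMeasurePreserving b (measurePreserving_mul_left μ h⁻¹)] with g hg
  rw [leftTranslate, hg, Function.comp_apply]

/-- `f ∈ RUC(G)`: uniform continuity for the right uniformity, generated by the entourages
`{(x, y) | x y⁻¹ ∈ U}` with `U` a neighbourhood of the identity. -/
def IsRUC (f : G →ᵇ ℝ) : Prop :=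
  ∀ ε > 0, ∃ U ∈ 𝓝 (1 : G), ∀ x y : G, x * y⁻¹ ∈ U → |f x - f y| < ε

/-- The translate `(f · g)(x) = f(gx)`. -/
def shift (f : G →ᵇ ℝ) (g : G) : G →ᵇ ℝ :=
  f.compContinuous ⟨fun x => g * x, continuous_const_mul g⟩

/-- The (right) co-`𝔅`-small functions: those `f ∈ RUC(G)` for which the orbit `f · G` is
co-`𝔅`-small in `L^∞(G) = L¹(G)*`. They are seen as elements of `L^∞(G) = L¹(G)*`. -/
def coSmallFunctions (𝔅 : FamilyClass.{u}) : Set (StrongDual ℝ (Lp ℝ 1 μ)) :=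
  toFunctional μ ''
    {f | IsRUC f ∧ IsCoSmall 𝔅 (Set.range fun g : G => toFunctional μ (shift f g))}

end GroupAlgebra

end

/-!
The two sets agree as soon as `𝔅` is stable under composition with continuous maps, descends along
continuous surjections and is polarly compatible (`coSmallFunctionals_eq_coSmallFunctions`).

*Both sets consist of right uniformly continuous functions*: `ruc(L¹(G)) = RUC(G)` (`mem_ruc_iff`).
If `f` is right uniformly continuous, it is the norm limit of `f · a` along an approximate identity.
Conversely, for `a` continuous with compact support, `φ · a` is the function `g ↦ φ(a ⋆ δ_g)`, which
is right uniformly continuous; `RUC(G)` is closed since `f ↦ ∫ · f` is isometric.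

*The two smallness conditions agree.* The orbit `f · G` lies in the weak-star closure of `f · B`,
where `B` is the unit ball of `L¹(G)`, because point masses are limits of normalised indicator
functions. So smallness of `f · B` gives that of `f · G`. For the converse, let `K` be the weak-star
closure of `f · G`. The barycentre map sends the dual ball of `C(K)` onto a compact set `L` of
functionals. Every `f · a` with `a ∈ B` is in `L`: it is the barycentre of the image of `a(h) dh`
under the orbit map. Polar compatibility gives smallness on the dual ball, hence on its image `L`,
hence on the weak-star closure of `f · B`.

For the three concrete classes only these stability properties are verified, the essential one
being polar compatibility. A functional on `C(K)` is a difference of two finite measures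
(`exists_measures_eq_sub_integral`), so bounded pointwise convergent sequences are weakly Cauchy.

* `[DLP]`: a sequence with the double limit property has a subsequence that converges pointwise to a
  continuous function, hence weakly. A weak-star cluster point then interchanges the limits.
* `[NP]`: a sequence in a fragmented family has countable uniform nets, so its values on functionals
  form a norm separable subset of `ℓ^∞`. A family that is not fragmented on the dual ball contains a
  sequence that uniformly separates a Cantor set of functionals.
* `[T]`: Rosenthal's dichotomy (`exists_subseq_tendsto_of_not_independent`) gives weakly Cauchy
  subsequences, which independent sequences do not have. The dichotomy is proved by a game of length
  `ω` with moves from an ultrafilter, which replaces the Ramsey theorem for closed sets.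
-/

set_option linter.unusedSectionVars false

/-! ### Co-smallness of the image of the unit ball and of the orbit -/

section GroupAlgebraCore

variable {G : Type u} [Group G] [TopologicalSpace G] [IsTopologicalGroup G]
  [LocallyCompactSpace G] [MeasurableSpace G] [BorelSpace G]
  (μ : Measure G) [μ.IsHaarMeasure] [μ.Regular]

theorem norm_toFunctional_le (f : G →ᵇ ℝ) : ‖toFunctional μ f‖ ≤ ‖f‖ :=
  LinearMap.mkContinuous_norm_le _ (norm_nonneg _) _

/-- The coefficient `h ↦ φ(h · b)` of the left regular representation on `L¹(G)`. -/
noncomputable def translateCoeff (φ : StrongDual ℝ (Lp ℝ 1 μ)) (b : Lp ℝ 1 μ) : G →ᵇ ℝ :=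
  BoundedContinuousFunction.ofNormedAddCommGroup (fun h => φ (leftTranslate μ h b))
    (φ.continuous.comp (continuous_leftTranslate μ b)) (‖φ‖ * ‖b‖)
    (fun h => by simpa only [norm_leftTranslate] using φ.le_opNorm (leftTranslate μ h b))

theorem translateCoeff_apply (φ : StrongDual ℝ (Lp ℝ 1 μ)) (b : Lp ℝ 1 μ) (h : G) :
    translateCoeff μ φ b h = φ (leftTranslate μ h b) := rfl

/-- The functional `φ · a` is the average of the translates of `φ` with weight `a`. -/
theorem dualAct_l1Conv_apply (φ : StrongDual ℝ (Lp ℝ 1 μ)) (a b : Lp ℝ 1 μ) :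
    dualAct (l1Conv μ) φ a b = toFunctional μ (translateCoeff μ φ b) a := by
  change φ (l1Conv μ a b) = _
  rw [l1Conv_apply, ← ContinuousLinearMap.integral_comp_comm _ (integrable_conv μ a b),
    toFunctional_apply]
  refine integral_congr_ae (ae_of_all _ fun h => ?_)
  simp only [map_smul, smul_eq_mul, translateCoeff_apply]

theorem toFunctional_shift_apply (f : G →ᵇ ℝ) (h : G) (b : Lp ℝ 1 μ) :
    toFunctional μ (shift f h) b = toFunctional μ f (leftTranslate μ h b) := by
  have h1 : toFunctional μ f (leftTranslate μ h b) = ∫ g, b (h⁻¹ * g) * f g ∂μ := by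
    rw [toFunctional_apply]
    refine integral_congr_ae ?_
    filter_upwards [Lp.coeFn_compMeasurePreserving b (measurePreserving_mul_left μ h⁻¹)] with g hg
    rw [leftTranslate, hg, Function.comp_apply]
  rw [h1, toFunctional_apply,
    ← integral_mul_left_eq_self (fun g => b (h⁻¹ * g) * f g) h]
  simp [shift]

/-- An element of `L¹(G)` in the unit ball that is close to the point mass at `h`: a normalised
indicator function. -/
theorem exists_approx_dirac {h : G} {V : Set G} (hV : V ∈ 𝓝 h) :
    ∃ a : Lp ℝ 1 μ, ‖a‖ ≤ 1 ∧ ∀ (u : G →ᵇ ℝ) (c ε : ℝ), (∀ x ∈ V, |u x - c| ≤ ε) →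
      |toFunctional μ u a - c| ≤ ε := by
  obtain ⟨K, hK, hKV, hKc⟩ := local_compact_nhds hV
  set W := interior K with hW
  have hWm : MeasurableSet W := isOpen_interior.measurableSet
  have hWfin : μ W ≠ ⊤ := ((measure_mono interior_subset).trans_lt hKc.measure_lt_top).ne
  have hWpos : 0 < μ.real W := by
    refine ENNReal.toReal_pos ?_ hWfin
    exact (isOpen_interior.measure_pos μ ⟨h, mem_interior_iff_mem_nhds.2 hK⟩).ne'
  have hint : ∀ u : G →ᵇ ℝ, toFunctional μ u (indicatorConstLp 1 hWm hWfin (μ.real W)⁻¹) =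
      (μ.real W)⁻¹ * ∫ x in W, u x ∂μ := by
    intro u
    rw [toFunctional_apply, ← integral_const_mul, ← integral_indicator hWm]
    refine integral_congr_ae ?_
    filter_upwards [indicatorConstLp_coeFn (p := 1) (hs := hWm) (hμs := hWfin)
      (c := (μ.real W)⁻¹)] with x hx
    rw [hx]
    by_cases hxW : x ∈ W <;> simp [hxW]
  refine ⟨indicatorConstLp 1 hWm hWfin (μ.real W)⁻¹, ?_, fun u c ε hu => ?_⟩
  · rw [norm_indicatorConstLp one_ne_zero ENNReal.one_ne_top]
    simp [abs_of_pos hWpos, inv_mul_cancel₀ hWpos.ne']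
  · have hui : IntegrableOn u W μ :=
      Measure.integrableOn_of_bounded (M := ‖u‖) hWfin
        u.continuous.aestronglyMeasurable (ae_of_all _ u.norm_coe_le_norm)
    have hc : c = (μ.real W)⁻¹ * ∫ x in W, c ∂μ := by
      rw [setIntegral_const, smul_eq_mul, inv_mul_cancel_left₀ hWpos.ne']
    have hci : IntegrableOn (fun _ : G => c) W μ := integrableOn_const hWfin
    have h2 : |∫ x in W, (u x - c) ∂μ| ≤ ε * μ.real W :=
      norm_setIntegral_le_of_norm_le_const (f := fun x => u x - c) hWfin.lt_top
        fun x hx => hu x (hKV (interior_subset hx))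
    rw [hint]
    nth_rewrite 1 [hc]
    rw [← mul_sub, ← integral_sub hui hci, abs_mul, abs_of_pos (inv_pos.2 hWpos)]
    calc _ ≤ (μ.real W)⁻¹ * (ε * μ.real W) :=
          mul_le_mul_of_nonneg_left h2 (inv_pos.2 hWpos).le
      _ = ε := by field_simp

theorem norm_toFunctional (f : G →ᵇ ℝ) : ‖toFunctional μ f‖ = ‖f‖ := by
  refine le_antisymm (norm_toFunctional_le μ f)
    ((BoundedContinuousFunction.norm_le (norm_nonneg _)).2 fun x => ?_)
  refine le_of_forall_pos_le_add fun ε hε => ?_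
  have hV : {y | |f y - f x| ≤ ε} ∈ 𝓝 x := by
    filter_upwards [Metric.tendsto_nhds.1 f.continuous.continuousAt ε hε] with y hy
    exact (Real.dist_eq _ _ ▸ hy).le
  obtain ⟨a, ha, h⟩ := exists_approx_dirac μ hV
  have h1 := h f (f x) ε fun y hy => hy
  have h2 : |toFunctional μ f a| ≤ ‖toFunctional μ f‖ := by
    simpa using (toFunctional μ f).le_opNorm_of_le ha
  rw [Real.norm_eq_abs]
  have h3 := abs_sub_abs_le_abs_sub (f x) (toFunctional μ f a)
  rw [abs_sub_comm] at h3
  linarith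

/-- Every point of `G` is the limit of a filter on the unit ball of `L¹(G)`, in the duality with
bounded continuous functions. -/
theorem exists_filter_tendsto_dirac (h : G) :
    ∃ l : Filter (Lp ℝ 1 μ), l.NeBot ∧ (∀ᶠ a in l, ‖a‖ ≤ 1) ∧
      ∀ u : G →ᵇ ℝ, Tendsto (fun a => toFunctional μ u a) l (𝓝 (u h)) := by
  let P : Set G → Set (Lp ℝ 1 μ) := fun V => {a | ‖a‖ ≤ 1 ∧ ∀ (u : G →ᵇ ℝ) (c ε : ℝ),
    (∀ x ∈ V, |u x - c| ≤ ε) → |toFunctional μ u a - c| ≤ ε}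
  have hP : Monotone P := fun V V' hV a ha =>
    ⟨ha.1, fun u c ε hu => ha.2 u c ε fun x hx => hu x (hV hx)⟩
  refine ⟨(𝓝 h).lift' P, (lift'_neBot_iff hP).2 fun V hV => exists_approx_dirac μ hV, ?_, ?_⟩
  · exact mem_of_superset (mem_lift' univ_mem) fun a ha => ha.1
  · intro u
    refine Metric.tendsto_nhds.2 fun ε hε => ?_
    have hV : {y | |u y - u h| ≤ ε / 2} ∈ 𝓝 h := by
      filter_upwards [Metric.tendsto_nhds.1 u.continuous.continuousAt (ε / 2) (half_pos hε)]
        with y hy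
      exact (Real.dist_eq _ _ ▸ hy).le
    refine mem_of_superset (mem_lift' hV) fun a ha => ?_
    have := ha.2 u (u h) (ε / 2) fun y hy => hy
    change dist _ _ < ε
    rw [Real.dist_eq]
    linarith

/-- The orbit of `f` lies in the weak-star closure of `f · B`, where `B` is the unit ball of
`L¹(G)`. -/
theorem wsClosure_orbit_subset (f : G →ᵇ ℝ) :
    wsClosure (Set.range fun g : G => toFunctional μ (shift f g)) ⊆
      wsClosure (dualAct (l1Conv μ) (toFunctional μ f) '' Metric.closedBall 0 1) := by
  refine closure_minimal ?_ isClosed_closure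
  rintro _ ⟨_, ⟨h, rfl⟩, rfl⟩
  obtain ⟨l, hl, hl1, hl2⟩ := exists_filter_tendsto_dirac μ h
  refine mem_closure_of_tendsto (b := l)
    (f := fun a => StrongDual.toWeakDual (dualAct (l1Conv μ) (toFunctional μ f) a)) ?_ ?_
  · refine tendsto_iff_forall_eval_tendsto_topDualPairing.2 fun b => ?_
    change Tendsto (fun a => dualAct (l1Conv μ) (toFunctional μ f) a b) l
      (𝓝 (toFunctional μ (shift f h) b))
    simp only [dualAct_l1Conv_apply, toFunctional_shift_apply]
    exact hl2 _
  · filter_upwards [hl1] with a ha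
    exact ⟨_, ⟨a, by simpa using ha, rfl⟩, rfl⟩

theorem isBounded_orbit (f : G →ᵇ ℝ) :
    Bornology.IsBounded (Set.range fun g : G => toFunctional μ (shift f g)) := by
  refine isBounded_iff_forall_norm_le.2 ⟨‖f‖, ?_⟩
  rintro _ ⟨g, rfl⟩
  refine (norm_toFunctional_le μ _).trans
    ((BoundedContinuousFunction.norm_le (norm_nonneg _)).2 fun x => f.norm_coe_le_norm _)

theorem isBounded_dualAct_closedBall (φ : StrongDual ℝ (Lp ℝ 1 μ)) :
    Bornology.IsBounded (dualAct (l1Conv μ) φ '' Metric.closedBall 0 1) := by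
  refine isBounded_iff_forall_norm_le.2 ⟨‖φ‖ * ‖l1Conv μ‖, ?_⟩
  rintro _ ⟨a, ha, rfl⟩
  refine (φ.opNorm_comp_le _).trans (mul_le_mul_of_nonneg_left ?_ (norm_nonneg _))
  simpa using (l1Conv μ).le_opNorm_of_le (mem_closedBall_zero_iff.1 ha)

end GroupAlgebraCore

section RestrCLM

variable {E : Type u} [NormedAddCommGroup E] [NormedSpace ℝ E]

theorem norm_toStrongDual_le_of_mem_wsClosure {M : Set (StrongDual ℝ E)} {R : ℝ}
    (hM : ∀ φ ∈ M, ‖φ‖ ≤ R) {ψ : WeakDual ℝ E} (hψ : ψ ∈ wsClosure M) :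
    ‖WeakDual.toStrongDual ψ‖ ≤ R := by
  have h : wsClosure M ⊆ WeakDual.toStrongDual ⁻¹' Metric.closedBall 0 R := by
    refine closure_minimal ?_ (WeakDual.isClosed_closedBall 0 R)
    rintro _ ⟨φ, hφ, rfl⟩
    simpa using hM φ hφ
  simpa using h hψ

/-- The restriction operator of a norm bounded weak-star compact set of functionals, as a bounded
operator. -/
noncomputable def restrCLM (K : Set (WeakDual ℝ E)) [CompactSpace K] (R : ℝ) (hR : 0 ≤ R)
    (hK : ∀ ψ ∈ K, ‖WeakDual.toStrongDual ψ‖ ≤ R) : E →L[ℝ] C(K, ℝ) :=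
  LinearMap.mkContinuous
    { toFun := restr K
      map_add' := fun x y => by ext ψ; exact map_add (WeakDual.toStrongDual ψ.1) x y
      map_smul' := fun c x => by ext ψ; exact map_smul (WeakDual.toStrongDual ψ.1) c x } R
    (fun x => (ContinuousMap.norm_le _ (by positivity)).2 fun ψ =>
      (WeakDual.toStrongDual ψ.1).le_of_opNorm_le (hK ψ.1 ψ.2) x)

theorem IsCoSmall.mono {𝔅 : FamilyClass.{u}}
    (hcomp : ∀ (K₁ K₂ : Type u) [TopologicalSpace K₁] [CompactSpace K₁] [T2Space K₁]
      [TopologicalSpace K₂] [CompactSpace K₂] [T2Space K₂] (p : C(K₁, K₂)) (A : Set C(K₂, ℝ)),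
      A ∈ 𝔅 K₂ → (fun f : C(K₂, ℝ) => f.comp p) '' A ∈ 𝔅 K₁)
    {M N : Set (StrongDual ℝ E)} (hM : Bornology.IsBounded M) (hMN : wsClosure M ⊆ wsClosure N)
    (h : IsCoSmall 𝔅 N) : IsCoSmall 𝔅 M := by
  intro A hA
  obtain ⟨hN, hA'⟩ := h A hA
  refine ⟨hM, ?_⟩
  have := compactSpace_wsClosure hM
  have := compactSpace_wsClosure hN
  have := hcomp (wsClosure M) (wsClosure N) ⟨Set.inclusion hMN, continuous_inclusion hMN⟩ _ hA'
  rw [Set.image_image] at this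
  exact this

end RestrCLM

section Core

variable {G : Type u} [Group G] [TopologicalSpace G] [IsTopologicalGroup G]
  [LocallyCompactSpace G] [MeasurableSpace G] [BorelSpace G]
  (μ : Measure G) [μ.IsHaarMeasure] [μ.Regular]

/-- The image of the measure `a(h) dh` under a continuous map from `G` to a compact space `K`, as a
functional on `C(K)`. -/
noncomputable def pushforward {K : Type*} [TopologicalSpace K] [CompactSpace K] (orb : C(G, K))
    (a : Lp ℝ 1 μ) : StrongDual ℝ C(K, ℝ) :=
  LinearMap.mkContinuous
    { toFun := fun v =>
        toFunctional μ ((BoundedContinuousFunction.mkOfCompact v).compContinuous orb) a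
      map_add' := fun v w => by
        rw [toFunctional_apply, toFunctional_apply, toFunctional_apply,
          ← integral_add (integrable_mul_bounded μ _ a) (integrable_mul_bounded μ _ a)]
        exact integral_congr_ae (ae_of_all _ fun g => mul_add _ _ _)
      map_smul' := fun c v => by
        rw [toFunctional_apply, toFunctional_apply, RingHom.id_apply, ← integral_smul]
        exact integral_congr_ae (ae_of_all _ fun g => mul_left_comm _ _ _) } ‖a‖
    (fun v => by
      rw [mul_comm]
      refine ((toFunctional μ _).le_opNorm a).trans
        (mul_le_mul_of_nonneg_right ?_ (norm_nonneg _))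
      exact (norm_toFunctional_le μ _).trans ((BoundedContinuousFunction.norm_le
        (norm_nonneg _)).2 fun x => v.norm_coe_le_norm _))

theorem norm_pushforward_le {K : Type*} [TopologicalSpace K] [CompactSpace K] (orb : C(G, K))
    (a : Lp ℝ 1 μ) : ‖pushforward μ orb a‖ ≤ ‖a‖ :=
  LinearMap.mkContinuous_norm_le _ (norm_nonneg _) _

theorem pushforward_restr (φ : StrongDual ℝ (Lp ℝ 1 μ)) {K : Set (WeakDual ℝ (Lp ℝ 1 μ))}
    [CompactSpace K] (orb : C(G, K))
    (horb : ∀ g b, (orb g : WeakDual ℝ (Lp ℝ 1 μ)) b = φ (leftTranslate μ g b)) (a b : Lp ℝ 1 μ) :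
    pushforward μ orb a (restr K b) = dualAct (l1Conv μ) φ a b := by
  have key : (BoundedContinuousFunction.mkOfCompact (restr K b)).compContinuous orb =
      translateCoeff μ φ b := BoundedContinuousFunction.ext fun g => horb g b
  rw [dualAct_l1Conv_apply, ← key]
  rfl

/-- If the orbit of `f` is co-small, then so is `f · B`. With `K` the weak-star closure of the
orbit, every measure `ν` in the unit ball of `C(K)*` has a barycentre in the dual of `L¹(G)`. The
barycentres form a compact set that contains `f · B`, namely at the push-forwards of
the measures `a(h) dh`, and polar compatibility gives smallness on that set. -/
theorem isCoSmall_dualAct_of_isCoSmall_orbit {𝔅 : FamilyClass.{u}}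
    (hcomp : ∀ (K₁ K₂ : Type u) [TopologicalSpace K₁] [CompactSpace K₁] [T2Space K₁]
      [TopologicalSpace K₂] [CompactSpace K₂] [T2Space K₂] (p : C(K₁, K₂)) (A : Set C(K₂, ℝ)),
      A ∈ 𝔅 K₂ → (fun f : C(K₂, ℝ) => f.comp p) '' A ∈ 𝔅 K₁)
    (hof : ∀ (K₁ K₂ : Type u) [TopologicalSpace K₁] [CompactSpace K₁] [T2Space K₁]
      [TopologicalSpace K₂] [CompactSpace K₂] [T2Space K₂] (p : C(K₁, K₂)) (A : Set C(K₂, ℝ)),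
      Function.Surjective p → (fun f : C(K₂, ℝ) => f.comp p) '' A ∈ 𝔅 K₁ → A ∈ 𝔅 K₂)
    (hpol : IsPolarlyCompatible 𝔅) (f : G →ᵇ ℝ)
    (h : IsCoSmall 𝔅 (Set.range fun g : G => toFunctional μ (shift f g))) :
    IsCoSmall 𝔅 (dualAct (l1Conv μ) (toFunctional μ f) '' Metric.closedBall 0 1) := by
  intro A hA
  have hNb := isBounded_dualAct_closedBall μ (toFunctional μ f)
  refine ⟨hNb, ?_⟩
  obtain ⟨hMb, hKA⟩ := h A hA
  have := compactSpace_wsClosure hMb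
  have := compactSpace_wsClosure hNb
  set K := wsClosure (Set.range fun g : G => toFunctional μ (shift f g)) with hKdef
  set N := wsClosure (dualAct (l1Conv μ) (toFunctional μ f) '' Metric.closedBall 0 1) with hNdef
  have hKnorm : ∀ ψ ∈ K, ‖WeakDual.toStrongDual ψ‖ ≤ ‖f‖ := fun ψ hψ => by
    refine norm_toStrongDual_le_of_mem_wsClosure ?_ hψ
    rintro _ ⟨g, rfl⟩
    exact (norm_toFunctional_le μ _).trans
      ((BoundedContinuousFunction.norm_le (norm_nonneg _)).2 fun x => f.norm_coe_le_norm _)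
  let r := restrCLM K ‖f‖ (norm_nonneg _) hKnorm
  -- the barycentre map
  let p : dualBall C(K, ℝ) → WeakDual ℝ (Lp ℝ 1 μ) := fun ν =>
    StrongDual.toWeakDual ((WeakDual.toStrongDual ν.1).comp r)
  have hp : Continuous p := WeakDual.continuous_of_continuous_eval fun x =>
    (WeakDual.eval_continuous (r x)).comp continuous_subtype_val
  set L := Set.range p with hL
  have hLc : IsCompact L := isCompact_range hp
  have : CompactSpace L := isCompact_iff_compactSpace.1 hLc
  -- the orbit map, along which the measures `a(h) dh` are pushed forward
  let orb : C(G, K) := ⟨fun g => ⟨StrongDual.toWeakDual (toFunctional μ (shift f g)),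
    subset_closure ⟨_, ⟨g, rfl⟩, rfl⟩⟩, by
      refine Continuous.subtype_mk (WeakDual.continuous_of_continuous_eval fun b => ?_) _
      change Continuous fun g => toFunctional μ (shift f g) b
      simp only [toFunctional_shift_apply]
      exact (translateCoeff μ (toFunctional μ f) b).continuous⟩
  have hNL : N ⊆ L := by
    refine closure_minimal ?_ hLc.isClosed
    rintro _ ⟨_, ⟨a, ha, rfl⟩, rfl⟩
    refine ⟨⟨StrongDual.toWeakDual (pushforward μ orb a), ?_⟩, ?_⟩
    · refine mem_closedBall_zero_iff.2 ?_
      exact (norm_pushforward_le μ orb a).trans (mem_closedBall_zero_iff.1 ha)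
    · exact congrArg StrongDual.toWeakDual (ContinuousLinearMap.ext fun b =>
        pushforward_restr μ _ orb (fun g b => toFunctional_shift_apply μ f g b) a b)
  have h1 := hpol K _ hKA
  have h2 : restr L '' A ∈ 𝔅 L := by
    refine hof (dualBall C(K, ℝ)) L ⟨Set.rangeFactorization p, hp.subtype_mk _⟩ _
      Set.rangeFactorization_surjective ?_
    rw [Set.image_image] at h1 ⊢
    exact h1
  have h3 := hcomp N L ⟨Set.inclusion hNL, continuous_inclusion hNL⟩ _ h2
  rw [Set.image_image] at h3
  exact h3

end Core

/-! ### Right translations and the identification of `ruc(L¹(G))` with `RUC(G)` -/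

section RightUniform

variable {G : Type u} [Group G] [TopologicalSpace G] [IsTopologicalGroup G]
  [LocallyCompactSpace G] [MeasurableSpace G] [BorelSpace G]
  (μ : Measure G) [μ.IsHaarMeasure] [μ.Regular]

/-- `f ↦ ∫ · f`, as a linear isometry of the bounded continuous functions into `L¹(G)*`. -/
noncomputable def toFunctionalLI : (G →ᵇ ℝ) →ₗᵢ[ℝ] StrongDual ℝ (Lp ℝ 1 μ) where
  toFun := toFunctional μ
  map_add' f g := by
    ext a
    rw [_root_.add_apply, toFunctional_apply, toFunctional_apply, toFunctional_apply,
      ← integral_add (integrable_mul_bounded μ _ a) (integrable_mul_bounded μ _ a)]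
    exact integral_congr_ae (ae_of_all _ fun g => mul_add _ _ _)
  map_smul' c f := by
    ext a
    rw [RingHom.id_apply, _root_.smul_apply, toFunctional_apply, toFunctional_apply,
      ← integral_smul]
    exact integral_congr_ae (ae_of_all _ fun g => mul_left_comm _ _ _)
  norm_map' f := norm_toFunctional μ f

theorem toFunctionalLI_apply (f : G →ᵇ ℝ) : toFunctionalLI μ f = toFunctional μ f := rfl

/-- `RUC(G)`, as a linear subspace of the bounded continuous functions. -/
def rucSubmodule (G : Type*) [Group G] [TopologicalSpace G] : Submodule ℝ (G →ᵇ ℝ) where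
  carrier := {f | IsRUC f}
  zero_mem' := fun ε hε => ⟨Set.univ, univ_mem, fun x y _ => by simpa using hε⟩
  add_mem' := by
    intro f g hf hg ε hε
    obtain ⟨U, hU, hfU⟩ := hf (ε / 2) (half_pos hε)
    obtain ⟨V, hV, hgV⟩ := hg (ε / 2) (half_pos hε)
    refine ⟨U ∩ V, inter_mem hU hV, fun x y hxy => ?_⟩
    have h1 := abs_lt.1 (hfU x y hxy.1)
    have h2 := abs_lt.1 (hgV x y hxy.2)
    rw [BoundedContinuousFunction.add_apply, BoundedContinuousFunction.add_apply, abs_lt]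
    constructor <;> linarith
  smul_mem' := by
    intro c f hf ε hε
    obtain ⟨U, hU, hfU⟩ := hf (ε / (|c| + 1)) (by positivity)
    refine ⟨U, hU, fun x y hxy => ?_⟩
    have h1 := hfU x y hxy
    rw [lt_div_iff₀ (by positivity)] at h1
    rw [BoundedContinuousFunction.smul_apply, BoundedContinuousFunction.smul_apply,
      smul_eq_mul, smul_eq_mul, ← mul_sub, abs_mul]
    nlinarith [abs_nonneg (f x - f y)]

theorem isClosed_rucSubmodule : IsClosed (rucSubmodule G : Set (G →ᵇ ℝ)) := by
  refine isClosed_of_closure_subset fun f hf ε hε => ?_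
  obtain ⟨g, hg, hfg⟩ := Metric.mem_closure_iff.1 hf (ε / 3) (by positivity)
  obtain ⟨U, hU, hgU⟩ := hg (ε / 3) (by positivity)
  refine ⟨U, hU, fun x y hxy => ?_⟩
  have h1 := abs_lt.1 (hgU x y hxy)
  have h (z : G) : |f z - g z| < ε / 3 :=
    (Real.dist_eq _ _ ▸ BoundedContinuousFunction.dist_coe_le_dist z).trans_lt hfg
  have h2 := abs_lt.1 (h x)
  have h3 := abs_lt.1 (h y)
  rw [abs_lt]
  constructor <;> linarith

theorem isClosed_image_rucSubmodule :
    IsClosed ((rucSubmodule G).map (toFunctionalLI μ).toLinearMap :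
      Set (StrongDual ℝ (Lp ℝ 1 μ))) := by
  rw [Submodule.map_coe]
  exact (toFunctionalLI μ).isometry.isClosedEmbedding.isClosedMap _ isClosed_rucSubmodule

/-- A right uniformly continuous function is the norm limit of the functionals `f · a`, where `a`
runs through an approximate identity. -/
theorem toFunctional_mem_ruc {f : G →ᵇ ℝ} (hf : IsRUC f) :
    toFunctional μ f ∈ ruc (l1Conv μ) := by
  refine Metric.mem_closure_iff.2 fun ε hε => ?_
  obtain ⟨U, hU, hfU⟩ := hf (ε / 2) (half_pos hε)
  obtain ⟨a, -, ha⟩ := exists_approx_dirac μ hU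
  refine ⟨dualAct (l1Conv μ) (toFunctional μ f) a, Submodule.subset_span ⟨_, _, rfl⟩, ?_⟩
  rw [dist_comm, dist_eq_norm]
  refine lt_of_le_of_lt (ContinuousLinearMap.opNorm_le_bound _ (half_pos hε).le fun b => ?_)
    (half_lt_self hε)
  rw [_root_.sub_apply, dualAct_l1Conv_apply, Real.norm_eq_abs]
  refine ha _ _ _ fun h hh => ?_
  rw [translateCoeff_apply, ← toFunctional_shift_apply, ← _root_.sub_apply,
    ← toFunctionalLI_apply, ← toFunctionalLI_apply, ← map_sub]
  refine (toFunctionalLI μ (shift f h - f)).le_of_opNorm_le ?_ b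
  rw [LinearIsometry.norm_map]
  refine (BoundedContinuousFunction.norm_le (half_pos hε).le).2 fun x => ?_
  exact (hfU (h * x) x (by simpa using hh)).le

/-! ### Continuous functions with compact support in `L¹(G)` -/

/-- A continuous function with compact support as an element of `L¹(G)`. -/
noncomputable def ccToL1 (v : G → ℝ) (hv : Continuous v) (hvc : HasCompactSupport v) : Lp ℝ 1 μ :=
  (hv.integrable_of_hasCompactSupport hvc (μ := μ)).toL1 v

theorem coeFn_ccToL1 {v : G → ℝ} (hv : Continuous v) (hvc : HasCompactSupport v) :
    ccToL1 μ v hv hvc =ᵐ[μ] v := Integrable.coeFn_toL1 _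

theorem toFunctional_ccToL1 (f : G →ᵇ ℝ) {v : G → ℝ} (hv : Continuous v)
    (hvc : HasCompactSupport v) :
    toFunctional μ f (ccToL1 μ v hv hvc) = ∫ g, v g * f g ∂μ := by
  rw [toFunctional_apply]
  refine integral_congr_ae ?_
  filter_upwards [coeFn_ccToL1 μ hv hvc] with g hg
  rw [hg]

theorem norm_ccToL1_sub {v w : G → ℝ} (hv : Continuous v) (hvc : HasCompactSupport v)
    (hw : Continuous w) (hwc : HasCompactSupport w) :
    ‖ccToL1 μ v hv hvc - ccToL1 μ w hw hwc‖ = ∫ g, |v g - w g| ∂μ := by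
  rw [ccToL1, ccToL1, ← Integrable.toL1_sub, L1.norm_of_fun_eq_integral_norm]
  rfl

/-- Density of the continuous functions with compact support in `L¹(G)`. The group need not be a
normal space, so Urysohn's lemma is used for a compact and a closed set. -/
theorem exists_hasCompactSupport_integral_sub_le {w : G → ℝ} (hw : Integrable w μ) {ε : ℝ}
    (hε : 0 < ε) :
    ∃ v : G → ℝ, HasCompactSupport v ∧ Continuous v ∧ ∫ x, ‖w x - v x‖ ∂μ ≤ ε := by
  have hind : ∀ (c : ℝ) ⦃s : Set G⦄, MeasurableSet s → μ s < ⊤ → ∀ {ε : ENNReal}, ε ≠ 0 →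
      ∃ g : G → ℝ, eLpNorm (g - s.indicator fun _ => c) 1 μ ≤ ε ∧
        Continuous g ∧ HasCompactSupport g := by
    intro c s hs hμs ε hε
    obtain ⟨η, hη, hηc⟩ := exists_eLpNorm_indicator_le (μ := μ) (p := 1) ENNReal.one_ne_top c hε
    have hη2 : (η : ENNReal) / 2 ≠ 0 := by simpa using hη.ne'
    obtain ⟨K, hKs, hK, hKcl, hKμ⟩ := hs.exists_isCompact_isClosed_sdiff_lt hμs.ne hη2
    obtain ⟨V, hKV, hV, -, hVμ⟩ := hKcl.measurableSet.exists_isOpen_sdiff_lt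
      (hK.measure_lt_top (μ := μ)).ne hη2
    obtain ⟨f, hf1, hf0, hfc, hf01⟩ := exists_continuous_one_zero_of_isCompact hK hV.isClosed_compl
      (Set.disjoint_compl_right_iff_subset.2 hKV)
    refine ⟨fun x => f x * c, ?_, f.continuous.mul continuous_const, hfc.mul_right⟩
    refine le_trans (eLpNorm_mono fun x => ?_) (hηc (V \ K ∪ s \ K) ?_)
    · by_cases hxK : x ∈ K
      · simp [hf1 hxK, hKs hxK]
      · by_cases hxV : x ∈ V
        · rw [Set.indicator_of_mem (s := V \ K ∪ s \ K) (Or.inl ⟨hxV, hxK⟩)]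
          by_cases hxs : x ∈ s
          · simp only [Pi.sub_apply, Set.indicator_of_mem hxs]
            rw [show f x * c - c = (f x - 1) * c by ring, norm_mul]
            refine mul_le_of_le_one_left (norm_nonneg _) ?_
            rw [Real.norm_eq_abs, abs_le]
            constructor <;> linarith [(hf01 x).1, (hf01 x).2]
          · simp only [Pi.sub_apply, Set.indicator_of_notMem hxs, sub_zero, norm_mul]
            refine mul_le_of_le_one_left (norm_nonneg _) ?_
            rw [Real.norm_eq_abs, abs_le]
            constructor <;> linarith [(hf01 x).1, (hf01 x).2]
        · have h0 : f x = 0 := hf0 hxV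
          by_cases hxs : x ∈ s
          · rw [Set.indicator_of_mem (s := V \ K ∪ s \ K) (Or.inr ⟨hxs, hxK⟩)]
            simp [h0, hxs]
          · simp [h0, hxs]
    · exact (measure_union_le _ _).trans ((add_le_add hVμ.le hKμ.le).trans_eq
        (ENNReal.add_halves _))
  obtain ⟨v, hwv, hv, hvc⟩ := (memLp_one_iff_integrable.2 hw).induction_dense
    (P := fun v : G → ℝ => Continuous v ∧ HasCompactSupport v) ENNReal.one_ne_top hind
    (fun f g hf hg => ⟨hf.1.add hg.1, hf.2.add hg.2⟩)
    (fun f hf => hf.1.aestronglyMeasurable)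
    (ε := ENNReal.ofReal ε) (by simpa using hε)
  refine ⟨v, hvc, hv, ?_⟩
  have hi : Integrable (w - v) μ := hw.sub (hv.integrable_of_hasCompactSupport hvc)
  change ∫ x, ‖(w - v) x‖ ∂μ ≤ ε
  rw [← ENNReal.ofReal_le_ofReal_iff hε.le, ofReal_integral_norm_eq_lintegral_enorm hi,
    ← eLpNorm_one_eq_lintegral_enorm]
  exact hwv

theorem dense_ccToL1 :
    Dense {w : Lp ℝ 1 μ | ∃ v hv hvc, w = ccToL1 μ v hv hvc} := by
  refine Metric.dense_iff.2 fun w ε hε => ?_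
  obtain ⟨v, hvc, hv, hwv⟩ :=
    exists_hasCompactSupport_integral_sub_le μ (L1.integrable_coeFn w) (half_pos hε)
  refine ⟨ccToL1 μ v hv hvc, ?_, v, hv, hvc, rfl⟩
  rw [Metric.mem_ball, dist_comm, dist_eq_norm, L1.norm_eq_integral_norm]
  refine lt_of_le_of_lt (le_of_eq (integral_congr_ae ?_) |>.trans hwv) (half_lt_self hε)
  filter_upwards [Lp.coeFn_sub w (ccToL1 μ v hv hvc), coeFn_ccToL1 μ hv hvc] with x h1 h2
  rw [h1, Pi.sub_apply, h2]

/-- Elements of `L¹(G)` are determined by their integrals against continuous functions with compact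
support. If `v` is such a function and is close to `w` in `L¹(G)`, then the test function
`v / (|v| + δ)` shows that the norm of `v` is small. -/
theorem eq_zero_of_forall_toFunctional_eq_zero {w : Lp ℝ 1 μ}
    (h : ∀ f : G →ᵇ ℝ, HasCompactSupport f → toFunctional μ f w = 0) : w = 0 := by
  refine norm_le_zero_iff.1 (le_of_forall_pos_le_add fun ε hε => ?_)
  rw [zero_add]
  obtain ⟨_, ⟨v, hv, hvc, rfl⟩, hwv⟩ := Metric.mem_closure_iff.1 (dense_ccToL1 μ w) (ε / 3)
    (by positivity)
  rw [dist_eq_norm] at hwv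
  obtain ⟨δ, hδ, hδ'⟩ : ∃ δ > 0, δ * μ.real (tsupport v) ≤ ε / 3 := by
    refine ⟨ε / 3 / (μ.real (tsupport v) + 1), by positivity, ?_⟩
    rw [div_mul_eq_mul_div, div_le_iff₀ (by positivity)]
    gcongr
    linarith
  have hden : ∀ x, 0 < |v x| + δ := fun x => by positivity
  have hle : ∀ x, ‖v x / (|v x| + δ)‖ ≤ 1 := fun x => by
    rw [norm_div, Real.norm_eq_abs, Real.norm_eq_abs, abs_of_pos (hden x), div_le_one (hden x)]
    linarith
  let f : G →ᵇ ℝ := BoundedContinuousFunction.ofNormedAddCommGroup (fun x => v x / (|v x| + δ))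
    (hv.div (hv.abs.add continuous_const) fun x => (hden x).ne') 1 hle
  have hfc : HasCompactSupport f := hvc.mono fun x hx hx' => hx (by simp [f, hx'])
  have hfn : ‖f‖ ≤ 1 := (BoundedContinuousFunction.norm_le zero_le_one).2 hle
  have h1 : toFunctional μ f (ccToL1 μ v hv hvc) ≤ ε / 3 := by
    have h2 : toFunctional μ f (ccToL1 μ v hv hvc) =
        toFunctional μ f (ccToL1 μ v hv hvc - w) := by rw [map_sub, h f hfc, sub_zero]
    rw [h2]
    refine (le_abs_self _).trans (((toFunctional μ f).le_of_opNorm_le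
      ((norm_toFunctional_le μ f).trans hfn) _).trans ?_)
    rw [one_mul, norm_sub_rev]
    exact hwv.le
  have hvi := hv.integrable_of_hasCompactSupport hvc (μ := μ)
  have h3 : ‖ccToL1 μ v hv hvc‖ ≤ 2 * (ε / 3) := by
    have hts := (isClosed_tsupport v).measurableSet
    have hδi : Integrable ((tsupport v).indicator fun _ => δ) μ :=
      (integrable_indicator_iff hts).2
        (integrableOn_const (IsCompact.measure_lt_top hvc).ne)
    calc ‖ccToL1 μ v hv hvc‖ = ∫ x, |v x| ∂μ := L1.norm_of_fun_eq_integral_norm _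
      _ ≤ ∫ x, (v x * f x + (tsupport v).indicator (fun _ => δ) x) ∂μ := by
        refine integral_mono hvi.norm (Integrable.add ?_ hδi) fun x => ?_
        · exact hvi.mul_bdd (c := ‖f‖) f.continuous.aestronglyMeasurable
            (ae_of_all _ f.norm_coe_le_norm)
        · by_cases hx : x ∈ tsupport v
          · have : |v x| - δ ≤ v x * (v x / (|v x| + δ)) := by
              rw [← mul_div_assoc, le_div_iff₀ (hden x), ← abs_mul_abs_self (v x)]
              nlinarith
            simp only [Set.indicator_of_mem hx]
            change |v x| ≤ v x * (v x / (|v x| + δ)) + δ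
            linarith
          · simp [image_eq_zero_of_notMem_tsupport hx, Set.indicator_of_notMem hx]
      _ = toFunctional μ f (ccToL1 μ v hv hvc) + δ * μ.real (tsupport v) := by
        rw [integral_add _ hδi, toFunctional_ccToL1, integral_indicator hts, setIntegral_const,
          smul_eq_mul, mul_comm δ]
        exact hvi.mul_bdd (c := ‖f‖) f.continuous.aestronglyMeasurable
            (ae_of_all _ f.norm_coe_le_norm)
      _ ≤ 2 * (ε / 3) := by linarith
  have h4 := norm_le_norm_add_norm_sub' w (ccToL1 μ v hv hvc)
  linarith

/-! ### The modular function -/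

theorem continuous_integral_of_support_subset {a : G → ℝ} (hac : HasCompactSupport a)
    {F : G → G → ℝ} (hF : Continuous F.uncurry)
    (hFa : ∀ g x, x ∉ tsupport a → x * g⁻¹ ∉ tsupport a → F g x = 0) :
    Continuous fun g => ∫ x, F g x ∂μ := by
  refine continuous_iff_continuousAt.2 fun g₀ => ?_
  obtain ⟨N, hN, hNg⟩ := exists_compact_mem_nhds g₀
  have hk : IsCompact (tsupport a ∪ tsupport a * N) := IsCompact.union hac (IsCompact.mul hac hN)
  refine (continuousOn_integral_of_compact_support (f := F) hk hF.continuousOn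
    fun g x hg hx => hFa g x (fun h => hx (Or.inl h)) fun h => hx (Or.inr ?_)).continuousAt hNg
  exact ⟨_, h, g, hg, by simp⟩

theorem HasCompactSupport.comp_mul_right {a : G → ℝ} (hac : HasCompactSupport a) (g : G) :
    HasCompactSupport fun x => a (x * g) :=
  hac.comp_homeomorph (Homeomorph.mulRight g)

/-- Right translation scales the integral of continuous functions with compact support by a
continuous character `δ`, the modular function or its inverse, depending on conventions. -/
theorem exists_modular : ∃ δ : G → ℝ, Continuous δ ∧ (∀ g, 0 < δ g) ∧
    (∀ x y, δ (x * y) = δ x * δ y) ∧ ∀ (g : G) (F : G → ℝ), Continuous F → HasCompactSupport F →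
      ∫ x, F (x * g) ∂μ = δ g * ∫ x, F x ∂μ := by
  obtain ⟨⟨v, hv⟩, hvc, hv0, hv1⟩ : ∃ f : C(G, ℝ), HasCompactSupport f ∧ 0 ≤ f ∧ f 1 ≠ 0 :=
    exists_continuous_nonneg_pos 1
  have hpos : ∀ g, 0 < ∫ x, v (x * g) ∂μ := fun g =>
    (hv.comp (continuous_mul_const g)).integral_pos_of_hasCompactSupport_nonneg_nonzero
      (HasCompactSupport.comp_mul_right hvc g) (fun x => hv0 (x * g)) (x := g⁻¹) (by simpa using hv1)
  have hpos1 : 0 < ∫ x, v x ∂μ := by simpa using hpos 1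
  have hscale : ∀ g, ∃ c : ℝ, ∀ F : G → ℝ, Continuous F → HasCompactSupport F →
      ∫ x, F (x * g) ∂μ = c * ∫ x, F x ∂μ := by
    intro g
    refine ⟨Measure.haarScalarFactor (Measure.map (· * g) μ) μ, fun F hF hFc => ?_⟩
    have h1 := Measure.integral_isMulLeftInvariant_eq_smul_of_hasCompactSupport
      (Measure.map (· * g) μ) μ hF hFc
    have h2 : ∫ x, F x ∂(Measure.map (· * g) μ) = ∫ x, F (x * g) ∂μ :=
      (Homeomorph.mulRight g).isClosedEmbedding.measurableEmbedding.integral_map F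
    rw [h2] at h1
    simpa [integral_smul_nnreal_measure, NNReal.smul_def] using h1
  have hkey : ∀ (g : G) (F : G → ℝ), Continuous F → HasCompactSupport F →
      ∫ x, F (x * g) ∂μ = (∫ x, v (x * g) ∂μ) / (∫ x, v x ∂μ) * ∫ x, F x ∂μ := by
    intro g F hF hFc
    obtain ⟨c, hc⟩ := hscale g
    rw [hc F hF hFc, hc v hv hvc, mul_div_cancel_right₀ _ hpos1.ne']
  refine ⟨fun g => (∫ x, v (x * g) ∂μ) / (∫ x, v x ∂μ), ?_, fun g => div_pos (hpos g) hpos1, ?_,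
    hkey⟩
  · refine Continuous.div_const ?_ _
    have := continuous_integral_of_support_subset μ (F := fun g x => v (x * g⁻¹)) hvc
      (by fun_prop) (fun g x _ h => image_eq_zero_of_notMem_tsupport h)
    simpa [Function.comp_def] using this.comp continuous_inv
  · intro x y
    have := hkey x (fun z => v (z * y)) (hv.comp (continuous_mul_const y))
      (HasCompactSupport.comp_mul_right hvc y)
    simp only [mul_assoc] at this
    beta_reduce
    rw [this]
    ring

/-! ### Right translates -/

/-- For continuous `a` with compact support, `φ · a` is the integral against the function
`g ↦ φ(T g)`. Here `T g` is the convolution of `a` with the point mass at `g`, that is, the function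
`x ↦ δ(g) a(x g⁻¹)` with the character `δ` of `exists_modular`. This function is right uniformly
continuous since `‖T x - T y‖` only depends on `x y⁻¹`. -/
theorem exists_isRUC_dualAct_ccToL1 (φ : StrongDual ℝ (Lp ℝ 1 μ)) {a : G → ℝ} (ha : Continuous a)
    (hac : HasCompactSupport a) :
    ∃ f : G →ᵇ ℝ, IsRUC f ∧ dualAct (l1Conv μ) φ (ccToL1 μ a ha hac) = toFunctional μ f := by
  obtain ⟨δ, hδc, hδpos, hδmul, hδ⟩ := exists_modular μ
  have hδ1 : δ 1 = 1 := by
    have := hδmul 1 1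
    rw [mul_one] at this
    exact (mul_eq_left₀ (hδpos 1).ne').1 this.symm
  have hTc : ∀ g, Continuous fun x => δ g * a (x * g⁻¹) := fun g => by fun_prop
  have hTs : ∀ g, HasCompactSupport fun x => δ g * a (x * g⁻¹) := fun g =>
    (HasCompactSupport.comp_mul_right hac g⁻¹).mul_left
  let T : G → Lp ℝ 1 μ := fun g => ccToL1 μ _ (hTc g) (hTs g)
  let N : G → ℝ := fun g => ∫ x, |δ g * a (x * g⁻¹) - a x| ∂μ
  have hN : Continuous N := by
    refine continuous_integral_of_support_subset μ hac (by fun_prop) fun g x h1 h2 => ?_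
    simp [image_eq_zero_of_notMem_tsupport h1, image_eq_zero_of_notMem_tsupport h2]
  have hN1 : N 1 = 0 := by simp [N, hδ1]
  have hT : ∀ x y, ‖T x - T y‖ = N (x * y⁻¹) := by
    intro x y
    rw [norm_ccToL1_sub]
    have h1 := hδ y (fun s => |δ x * a (s * x⁻¹) - δ y * a (s * y⁻¹)|) (by fun_prop)
      (((hTs x).sub (hTs y)).abs)
    have h2 : ∀ s, |δ x * a (s * y * x⁻¹) - δ y * a (s * y * y⁻¹)| =
        δ y * |δ (x * y⁻¹) * a (s * (x * y⁻¹)⁻¹) - a s| := by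
      intro s
      have h3 : δ x = δ y * δ (x * y⁻¹) := by rw [mul_comm, ← hδmul, inv_mul_cancel_right]
      rw [← abs_of_pos (hδpos y), ← abs_mul, abs_of_pos (hδpos y), mul_sub, ← mul_assoc, ← h3,
        mul_inv_cancel_right, mul_inv_rev, inv_inv, mul_assoc]
    simp only [h2, integral_const_mul] at h1
    exact (mul_left_cancel₀ (hδpos y).ne' h1).symm
  have hTcont : Continuous T := by
    refine continuous_iff_continuousAt.2 fun y => tendsto_iff_norm_sub_tendsto_zero.2 ?_
    simp only [hT]
    have h1 : Tendsto (fun x => N (x * y⁻¹)) (𝓝 y) (𝓝 (N (y * y⁻¹))) :=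
      (hN.comp (continuous_mul_const y⁻¹)).tendsto y
    rwa [mul_inv_cancel, hN1] at h1
  have hTnorm : ∀ g, ‖T g‖ ≤ ∫ x, |a x| ∂μ := by
    intro g
    have h1 := hδ g (fun s => |δ g * a (s * g⁻¹)|) (by fun_prop) (hTs g).abs
    simp only [mul_inv_cancel_right, abs_mul, abs_of_pos (hδpos g), integral_const_mul] at h1
    have h2 : ‖T g‖ = ∫ x, |δ g * a (x * g⁻¹)| ∂μ := L1.norm_of_fun_eq_integral_norm _
    simp only [abs_mul, abs_of_pos (hδpos g), integral_const_mul] at h2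
    rw [h2, mul_left_cancel₀ (hδpos g).ne' h1]
  let f : G →ᵇ ℝ := BoundedContinuousFunction.ofNormedAddCommGroup (fun g => φ (T g))
    (φ.continuous.comp hTcont) (‖φ‖ * ∫ x, |a x| ∂μ) fun g => φ.le_opNorm_of_le (hTnorm g)
  -- the convolution as a superposition of right translates
  have hconv : ∀ (b : G → ℝ) (hb : Continuous b) (hbc : HasCompactSupport b),
      l1Conv μ (ccToL1 μ a ha hac) (ccToL1 μ b hb hbc) = ∫ g, b g • T g ∂μ := by
    intro b hb hbc
    have hbT : Integrable (fun g => b g • T g) μ :=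
      (hb.smul hTcont).integrable_of_hasCompactSupport hbc.smul_right
    refine sub_eq_zero.1 (eq_zero_of_forall_toFunctional_eq_zero μ fun u hu => ?_)
    rw [map_sub, sub_eq_zero]
    have hL : toFunctional μ u (l1Conv μ (ccToL1 μ a ha hac) (ccToL1 μ b hb hbc)) =
        ∫ h, ∫ g, a h * (b g * u (h * g)) ∂μ ∂μ := by
      change dualAct (l1Conv μ) (toFunctional μ u) _ _ = _
      rw [dualAct_l1Conv_apply, toFunctional_ccToL1]
      refine integral_congr_ae (ae_of_all _ fun h => ?_)
      beta_reduce
      rw [translateCoeff_apply, ← toFunctional_shift_apply, toFunctional_ccToL1,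
        ← integral_const_mul]
      rfl
    have hR : toFunctional μ u (∫ g, b g • T g ∂μ) =
        ∫ g, ∫ h, a h * (b g * u (h * g)) ∂μ ∂μ := by
      rw [← ContinuousLinearMap.integral_comp_comm _ hbT]
      refine integral_congr_ae (ae_of_all _ fun g => ?_)
      beta_reduce
      rw [map_smul, smul_eq_mul, toFunctional_ccToL1]
      have h1 := hδ g (fun x => a (x * g⁻¹) * u x) (by fun_prop)
        (HasCompactSupport.comp_mul_right hac g⁻¹).mul_right
      simp only [mul_inv_cancel_right] at h1
      simp only [mul_assoc, integral_const_mul]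
      rw [← h1, ← integral_const_mul]
      refine integral_congr_ae (ae_of_all _ fun x => ?_)
      beta_reduce
      ring
    rw [hL, hR]
    refine integral_integral_swap_of_hasCompactSupport (by fun_prop) ?_
    refine HasCompactSupport.intro (IsCompact.prod hac hbc) fun p hp => ?_
    rw [Set.mem_prod, not_and_or] at hp
    rcases hp with hp | hp <;> simp [Function.uncurry, image_eq_zero_of_notMem_tsupport hp]
  refine ⟨f, fun ε hε => ?_, ?_⟩
  · have h1 : {g | ‖φ‖ * N g < ε} ∈ 𝓝 (1 : G) := by
      refine (continuous_const.mul hN).isOpen_preimage _ isOpen_Iio |>.mem_nhds ?_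
      simpa [hN1] using hε
    refine ⟨_, h1, fun x y hxy => ?_⟩
    change |φ (T x) - φ (T y)| < ε
    rw [← map_sub]
    refine lt_of_le_of_lt (φ.le_opNorm _) ?_
    rw [hT]
    exact hxy
  · refine ContinuousLinearMap.ext_iff.2 fun b => ?_
    refine congrFun (Continuous.ext_on (dense_ccToL1 μ) (ContinuousLinearMap.continuous _)
      (ContinuousLinearMap.continuous _) ?_) b
    rintro _ ⟨v, hv, hvc, rfl⟩
    have hvT : Integrable (fun g => v g • T g) μ :=
      (hv.smul hTcont).integrable_of_hasCompactSupport hvc.smul_right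
    change φ (l1Conv μ _ _) = _
    rw [hconv v hv hvc, ← ContinuousLinearMap.integral_comp_comm _ hvT, toFunctional_ccToL1]
    refine integral_congr_ae (ae_of_all _ fun g => ?_)
    beta_reduce
    rw [map_smul, smul_eq_mul]
    rfl

theorem mem_ruc_iff {φ : StrongDual ℝ (Lp ℝ 1 μ)} :
    φ ∈ ruc (l1Conv μ) ↔ ∃ f : G →ᵇ ℝ, IsRUC f ∧ toFunctional μ f = φ := by
  refine ⟨fun h => ?_, ?_⟩
  · have key : ruc (l1Conv μ) ≤ (rucSubmodule G).map (toFunctionalLI μ).toLinearMap := by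
      refine Submodule.topologicalClosure_minimal _ (Submodule.span_le.2 ?_)
        (isClosed_image_rucSubmodule μ)
      rintro _ ⟨ψ, a, rfl⟩
      have hcont : Continuous fun a => dualAct (l1Conv μ) ψ a :=
        continuous_const.clm_comp (l1Conv μ).continuous
      have hcl := (isClosed_image_rucSubmodule μ).preimage hcont
      refine hcl.closure_subset_iff.2 ?_ (dense_ccToL1 μ a)
      rintro _ ⟨v, hv, hvc, rfl⟩
      obtain ⟨f, hf, hfv⟩ := exists_isRUC_dualAct_ccToL1 μ ψ hv hvc
      exact ⟨f, hf, hfv.symm⟩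
    obtain ⟨f, hf, hfφ⟩ := key h
    exact ⟨f, hf, hfφ⟩
  · rintro ⟨f, hf, rfl⟩
    exact toFunctional_mem_ruc μ hf

end RightUniform

/-- The comparison of co-small functionals and functions only uses the behaviour of the class under
composition with continuous maps and polar compatibility. -/
theorem coSmallFunctionals_eq_coSmallFunctions {G : Type u} [Group G] [TopologicalSpace G]
    [IsTopologicalGroup G] [LocallyCompactSpace G] [MeasurableSpace G] [BorelSpace G]
    (μ : Measure G) [μ.IsHaarMeasure] [μ.Regular] {𝔅 : FamilyClass.{u}}
    (hcomp : ∀ (K₁ K₂ : Type u) [TopologicalSpace K₁] [CompactSpace K₁] [T2Space K₁]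
      [TopologicalSpace K₂] [CompactSpace K₂] [T2Space K₂] (p : C(K₁, K₂)) (A : Set C(K₂, ℝ)),
      A ∈ 𝔅 K₂ → (fun f : C(K₂, ℝ) => f.comp p) '' A ∈ 𝔅 K₁)
    (hof : ∀ (K₁ K₂ : Type u) [TopologicalSpace K₁] [CompactSpace K₁] [T2Space K₁]
      [TopologicalSpace K₂] [CompactSpace K₂] [T2Space K₂] (p : C(K₁, K₂)) (A : Set C(K₂, ℝ)),
      Function.Surjective p → (fun f : C(K₂, ℝ) => f.comp p) '' A ∈ 𝔅 K₁ → A ∈ 𝔅 K₂)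
    (hpol : IsPolarlyCompatible 𝔅) :
    coSmallFunctionals (l1Conv μ) 𝔅 = coSmallFunctions μ 𝔅 := by
  ext φ
  constructor
  · rintro ⟨hφ, hsmall⟩
    obtain ⟨f, hf, rfl⟩ := (mem_ruc_iff μ).1 hφ
    exact ⟨f, ⟨hf, hsmall.mono hcomp (isBounded_orbit μ f) (wsClosure_orbit_subset μ f)⟩, rfl⟩
  · rintro ⟨f, ⟨hf, hsmall⟩, rfl⟩
    exact ⟨toFunctional_mem_ruc μ hf,
      isCoSmall_dualAct_of_isCoSmall_orbit μ hcomp hof hpol f hsmall⟩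

/-! ### Functionals on `C(K)` as differences of two measures -/

section JordanDecomposition

variable {K : Type*} [TopologicalSpace K] [CompactSpace K]

/-- The positive part of a functional `ν` on `C(K)`, at functions `g ≥ 0`. -/
noncomputable def dualPosPart (ν : StrongDual ℝ C(K, ℝ)) (g : C(K, ℝ)) : ℝ :=
  sSup (ν '' Set.Icc 0 g)

variable (ν : StrongDual ℝ C(K, ℝ))

theorem bddAbove_image_Icc (g : C(K, ℝ)) : BddAbove (ν '' Set.Icc 0 g) := by
  refine ⟨‖ν‖ * ‖g‖, ?_⟩
  rintro _ ⟨h, ⟨h0, hg⟩, rfl⟩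
  refine (le_abs_self _).trans (ν.le_opNorm_of_le ?_)
  refine (ContinuousMap.norm_le _ (norm_nonneg _)).2 fun x => ?_
  have hx : 0 ≤ h x := h0 x
  rw [Real.norm_eq_abs, abs_of_nonneg hx]
  exact (hg x).trans ((le_abs_self _).trans (g.norm_coe_le_norm x))

theorem le_dualPosPart {g h : C(K, ℝ)} (h0 : 0 ≤ h) (hg : h ≤ g) : ν h ≤ dualPosPart ν g :=
  le_csSup (bddAbove_image_Icc ν g) ⟨h, ⟨h0, hg⟩, rfl⟩

theorem dualPosPart_le {g : C(K, ℝ)} (hg : 0 ≤ g) {c : ℝ}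
    (h : ∀ h : C(K, ℝ), 0 ≤ h → h ≤ g → ν h ≤ c) : dualPosPart ν g ≤ c := by
  refine csSup_le ⟨_, 0, ⟨le_rfl, hg⟩, rfl⟩ ?_
  rintro _ ⟨k, ⟨h0, hk⟩, rfl⟩
  exact h k h0 hk

theorem dualPosPart_nonneg {g : C(K, ℝ)} (hg : 0 ≤ g) : 0 ≤ dualPosPart ν g := by
  simpa using le_dualPosPart ν le_rfl hg

theorem dualPosPart_add {g₁ g₂ : C(K, ℝ)} (h₁ : 0 ≤ g₁) (h₂ : 0 ≤ g₂) :
    dualPosPart ν (g₁ + g₂) = dualPosPart ν g₁ + dualPosPart ν g₂ := by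
  refine le_antisymm (dualPosPart_le ν (add_nonneg h₁ h₂) fun h h0 hg => ?_) ?_
  · have hsplit : h = h ⊓ g₁ + (h - h ⊓ g₁) := by abel
    rw [hsplit, map_add]
    refine add_le_add (le_dualPosPart ν (le_inf h0 h₁) inf_le_right)
      (le_dualPosPart ν (sub_nonneg.2 inf_le_left) fun x => ?_)
    have h3 : 0 ≤ g₂ x := h₂ x
    have h5 : h x ≤ g₁ x + g₂ x := hg x
    change h x - min (h x) (g₁ x) ≤ g₂ x
    rcases min_cases (h x) (g₁ x) with ⟨h4, -⟩ | ⟨h4, -⟩ <;> rw [h4] <;> linarith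
  · rw [← le_sub_iff_add_le]
    refine dualPosPart_le ν h₁ fun k k0 hk => ?_
    rw [le_sub_comm]
    refine dualPosPart_le ν h₂ fun l l0 hl => ?_
    rw [le_sub_iff_add_le, add_comm, ← map_add]
    exact le_dualPosPart ν (add_nonneg k0 l0) (add_le_add hk hl)

theorem dualPosPart_smul_le {g : C(K, ℝ)} (hg : 0 ≤ g) {c : ℝ} (hc : 0 < c) :
    dualPosPart ν (c • g) ≤ c * dualPosPart ν g := by
  refine dualPosPart_le ν (smul_nonneg hc.le hg) fun h h0 hh => ?_
  have h1 : ν (c⁻¹ • h) ≤ dualPosPart ν g := by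
    refine le_dualPosPart ν (smul_nonneg (inv_pos.2 hc).le h0) fun x => ?_
    have : h x ≤ c * g x := hh x
    change c⁻¹ * h x ≤ g x
    rwa [inv_mul_le_iff₀ hc]
  rwa [map_smul, smul_eq_mul, inv_mul_le_iff₀ hc] at h1

theorem dualPosPart_smul {g : C(K, ℝ)} (hg : 0 ≤ g) {c : ℝ} (hc : 0 ≤ c) :
    dualPosPart ν (c • g) = c * dualPosPart ν g := by
  rcases hc.eq_or_lt with rfl | hc
  · rw [zero_smul, zero_mul]
    exact le_antisymm (dualPosPart_le ν le_rfl fun h h0 h1 => by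
      rw [le_antisymm h1 h0, map_zero]) (dualPosPart_nonneg ν le_rfl)
  · refine le_antisymm (dualPosPart_smul_le ν hg hc) ?_
    have := dualPosPart_smul_le ν (smul_nonneg hc.le hg) (inv_pos.2 hc)
    rwa [inv_smul_smul₀ hc.ne', ← div_eq_inv_mul, le_div_iff₀' hc] at this

open scoped CompactlySupported NNReal

/-- A nonnegative function, seen as a real-valued function. -/
def nnrealToReal (g : C_c(K, ℝ≥0)) : C(K, ℝ) :=
  ⟨fun x => (g x : ℝ), NNReal.continuous_coe.comp g.continuous⟩

theorem nnrealToReal_nonneg (g : C_c(K, ℝ≥0)) : 0 ≤ nnrealToReal g := fun x => (g x).2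

/-- A functional on `C(K)` that is additive, homogeneous and nonnegative on the positive cone is
given there by a finite measure. -/
theorem exists_measure_of_additive [T2Space K] [MeasurableSpace K] [BorelSpace K]
    (P : C(K, ℝ) → ℝ) (h0 : ∀ g, 0 ≤ g → 0 ≤ P g)
    (hadd : ∀ g₁ g₂, 0 ≤ g₁ → 0 ≤ g₂ → P (g₁ + g₂) = P g₁ + P g₂)
    (hsmul : ∀ (c : ℝ) (g), 0 ≤ c → 0 ≤ g → P (c • g) = c * P g) :
    ∃ m : Measure K, IsFiniteMeasure m ∧ ∀ g : C(K, ℝ), 0 ≤ g → P g = ∫ x, g x ∂m := by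
  let Λ : C_c(K, ℝ≥0) →ₗ[ℝ≥0] ℝ≥0 :=
    { toFun := fun g => ⟨P (nnrealToReal g), h0 _ (nnrealToReal_nonneg g)⟩
      map_add' := fun f g => NNReal.eq (hadd _ _ (nnrealToReal_nonneg f) (nnrealToReal_nonneg g))
      map_smul' := fun c g => NNReal.eq (hsmul c _ c.2 (nnrealToReal_nonneg g)) }
  have hfin : IsFiniteMeasure (NNRealRMK.rieszMeasure Λ) := by
    have : IsFiniteMeasureOnCompacts (NNRealRMK.rieszMeasure Λ) := inferInstance
    exact CompactSpace.isFiniteMeasure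
  refine ⟨NNRealRMK.rieszMeasure Λ, hfin, fun g hg => ?_⟩
  let g' : C_c(K, ℝ≥0) :=
    ⟨⟨fun x => (g x).toNNReal, continuous_real_toNNReal.comp g.continuous⟩,
      HasCompactSupport.of_compactSpace _⟩
  have hg' : nnrealToReal g' = g := ContinuousMap.ext fun x => Real.coe_toNNReal _ (hg x)
  have h1 : ∫ x, nnrealToReal g' x ∂(NNRealRMK.rieszMeasure Λ) = P (nnrealToReal g') :=
    NNRealRMK.integral_rieszMeasure Λ g'
  rw [hg'] at h1
  exact h1.symm

/-- The Jordan decomposition of a functional on `C(K)`. -/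
theorem exists_measures_eq_sub_integral [T2Space K] [MeasurableSpace K] [BorelSpace K] :
    ∃ m₁ m₂ : Measure K, IsFiniteMeasure m₁ ∧ IsFiniteMeasure m₂ ∧
      ∀ f : C(K, ℝ), ν f = ∫ x, f x ∂m₁ - ∫ x, f x ∂m₂ := by
  obtain ⟨m₁, hm₁, h₁⟩ := exists_measure_of_additive (dualPosPart ν)
    (fun g hg => dualPosPart_nonneg ν hg) (fun g₁ g₂ => dualPosPart_add ν)
    (fun c g hc hg => dualPosPart_smul ν hg hc)
  obtain ⟨m₂, hm₂, h₂⟩ := exists_measure_of_additive (fun g => dualPosPart ν g - ν g)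
    (fun g hg => sub_nonneg.2 (le_dualPosPart ν hg le_rfl))
    (fun g₁ g₂ hg₁ hg₂ => by
      rw [dualPosPart_add ν hg₁ hg₂, map_add]
      ring)
    (fun c g hc hg => by
      rw [dualPosPart_smul ν hg hc, map_smul, smul_eq_mul]
      ring)
  refine ⟨m₁, m₂, hm₁, hm₂, fun f => ?_⟩
  have hpos : ∀ g : C(K, ℝ), 0 ≤ g → ν g = ∫ x, g x ∂m₁ - ∫ x, g x ∂m₂ := fun g hg => by
    rw [← h₁ g hg, ← h₂ g hg]
    ring
  have hint : ∀ (m : Measure K) [IsFiniteMeasure m] (g : C(K, ℝ)), Integrable g m := fun m _ g =>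
    g.continuous.integrable_of_hasCompactSupport (HasCompactSupport.of_compactSpace _)
  -- a function is the difference of the nonnegative functions `f ⊔ 0` and `f ⊔ 0 - f`
  have e1 := hpos (f ⊔ 0) le_sup_right
  have e2 := hpos (f ⊔ 0 - f) (sub_nonneg.2 le_sup_left)
  simp only [ContinuousMap.sub_apply] at e2
  rw [map_sub, integral_sub (hint m₁ _) (hint m₁ _), integral_sub (hint m₂ _) (hint m₂ _)] at e2
  linarith

/-- A bounded sequence in `C(K)` that converges pointwise to some function is weakly Cauchy. -/
theorem exists_tendsto_apply_of_tendsto_pointwise [T2Space K] (ν : StrongDual ℝ C(K, ℝ))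
    {f : ℕ → C(K, ℝ)} {R : ℝ} (hR : ∀ n x, |f n x| ≤ R) {g : K → ℝ}
    (hfg : ∀ x, Tendsto (fun n => f n x) atTop (𝓝 (g x))) :
    ∃ c, Tendsto (fun n => ν (f n)) atTop (𝓝 c) ∧
      ∀ g' : C(K, ℝ), (∀ x, g' x = g x) → ν g' = c := by
  borelize K
  obtain ⟨m₁, m₂, hm₁, hm₂, h⟩ := exists_measures_eq_sub_integral ν
  have key : ∀ (m : Measure K) [IsFiniteMeasure m],
      Tendsto (fun n => ∫ x, f n x ∂m) atTop (𝓝 (∫ x, g x ∂m)) := fun m _ =>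
    tendsto_integral_of_dominated_convergence (fun _ => R)
      (fun n => (f n).continuous.aestronglyMeasurable_of_compactSpace) (integrable_const R)
      (fun n => ae_of_all _ (hR n)) (ae_of_all _ hfg)
  refine ⟨∫ x, g x ∂m₁ - ∫ x, g x ∂m₂, ?_, fun g' hg' => ?_⟩
  · simp only [h]
    exact (key m₁).sub (key m₂)
  · rw [h]
    simp only [hg']

end JordanDecomposition

/-! ### Boundedness of families of continuous functions -/

section Bounded

variable {K : Type*} [TopologicalSpace K] [CompactSpace K]

theorem isBounded_iff_pointwise {A : Set C(K, ℝ)} :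
    Bornology.IsBounded A ↔ ∃ R, ∀ f ∈ A, ∀ x, |f x| ≤ R := by
  rw [isBounded_iff_forall_norm_le]
  constructor
  · rintro ⟨R, hR⟩
    exact ⟨R, fun f hf x => (f.norm_coe_le_norm x).trans (hR f hf)⟩
  · rintro ⟨R, hR⟩
    exact ⟨max R 0, fun f hf => (ContinuousMap.norm_le _ (le_max_right _ _)).2 fun x =>
      (hR f hf x).trans (le_max_left _ _)⟩

variable {K' : Type*} [TopologicalSpace K'] [CompactSpace K']

theorem isBounded_image_comp (p : C(K', K)) {A : Set C(K, ℝ)} (hA : Bornology.IsBounded A) :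
    Bornology.IsBounded ((fun f : C(K, ℝ) => f.comp p) '' A) := by
  obtain ⟨R, hR⟩ := isBounded_iff_pointwise.1 hA
  refine isBounded_iff_pointwise.2 ⟨R, ?_⟩
  rintro _ ⟨f, hf, rfl⟩ x
  exact hR f hf (p x)

theorem isBounded_of_image_comp (p : C(K', K)) (hp : Function.Surjective p) {A : Set C(K, ℝ)}
    (hA : Bornology.IsBounded ((fun f : C(K, ℝ) => f.comp p) '' A)) : Bornology.IsBounded A := by
  obtain ⟨R, hR⟩ := isBounded_iff_pointwise.1 hA
  refine isBounded_iff_pointwise.2 ⟨R, fun f hf x => ?_⟩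
  obtain ⟨y, rfl⟩ := hp x
  exact hR _ ⟨f, hf, rfl⟩ y

theorem isBounded_image_restr_dualBall {E : Type u} [NormedAddCommGroup E] [NormedSpace ℝ E]
    {A : Set E} (hA : Bornology.IsBounded A) :
    Bornology.IsBounded (restr (dualBall E) '' A) := by
  obtain ⟨R, hR⟩ := isBounded_iff_forall_norm_le.1 hA
  refine isBounded_iff_pointwise.2 ⟨R, ?_⟩
  rintro _ ⟨f, hf, rfl⟩ ν
  have h := (WeakDual.toStrongDual ν.1).le_of_opNorm_le (mem_closedBall_zero_iff.1 ν.2) f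
  rw [one_mul] at h
  exact h.trans (hR f hf)

end Bounded

/-! ### The double limit property -/

section DLP

theorem hasDLP_image_iff {K : Type*} [TopologicalSpace K] {A : Set C(K, ℝ)} :
    HasDLP ((fun f : C(K, ℝ) => (f : K → ℝ)) '' A) ↔
      ∀ (f : ℕ → C(K, ℝ)) (x : ℕ → K), (∀ n, f n ∈ A) → ∀ (p q : ℕ → ℝ) (s t : ℝ),
        (∀ n, Tendsto (fun m => f n (x m)) atTop (𝓝 (p n))) → Tendsto p atTop (𝓝 s) →
        (∀ m, Tendsto (fun n => f n (x m)) atTop (𝓝 (q m))) → Tendsto q atTop (𝓝 t) →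
        s = t := by
  constructor
  · intro h f x hf p q s t
    exact h (fun n => f n) x (fun n => ⟨f n, hf n, rfl⟩) p q s t
  · intro h f x hf p q s t
    choose g hg hgf using hf
    obtain rfl : (fun n => (g n : K → ℝ)) = f := funext hgf
    exact h g x hg p q s t

theorem comp_mem_dlpClass (K₁ K₂ : Type u) [TopologicalSpace K₁] [CompactSpace K₁] [T2Space K₁]
    [TopologicalSpace K₂] [CompactSpace K₂] [T2Space K₂] (p : C(K₁, K₂)) (A : Set C(K₂, ℝ))
    (hA : A ∈ dlpClass K₂) : (fun f : C(K₂, ℝ) => f.comp p) '' A ∈ dlpClass K₁ := by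
  refine ⟨isBounded_image_comp p hA.1, hasDLP_image_iff.2 fun f x hf => ?_⟩
  choose g hg hgf using hf
  obtain rfl : (fun n => (g n).comp p) = f := funext hgf
  exact hasDLP_image_iff.1 hA.2 g (fun m => p (x m)) hg

theorem mem_dlpClass_of_comp (K₁ K₂ : Type u) [TopologicalSpace K₁] [CompactSpace K₁] [T2Space K₁]
    [TopologicalSpace K₂] [CompactSpace K₂] [T2Space K₂] (p : C(K₁, K₂)) (A : Set C(K₂, ℝ))
    (hp : Function.Surjective p) (hA : (fun f : C(K₂, ℝ) => f.comp p) '' A ∈ dlpClass K₁) :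
    A ∈ dlpClass K₂ := by
  refine ⟨isBounded_of_image_comp p hp hA.1, hasDLP_image_iff.2 fun f x hf => ?_⟩
  choose y hy using fun m => hp (x m)
  obtain rfl : (fun m => p (y m)) = x := funext hy
  exact hasDLP_image_iff.1 hA.2 (fun n => (f n).comp p) y fun n => ⟨f n, hf n, rfl⟩

variable {K : Type*} [TopologicalSpace K]

/-- With respect to countably many functions, points in the closure of a set are limits of sequences
from the set. -/
theorem exists_seq_tendsto_of_mem_closure (f : ℕ → C(K, ℝ)) {S : Set K} {x : K}
    (hx : (fun n => f n x) ∈ closure ((fun y n => f n y) '' S)) :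
    ∃ y : ℕ → K, (∀ m, y m ∈ S) ∧ ∀ n, Tendsto (fun m => f n (y m)) atTop (𝓝 (f n x)) := by
  obtain ⟨z, hz, hzx⟩ := mem_closure_iff_seq_limit.1 hx
  choose y hy hyz using hz
  refine ⟨y, hy, fun n => ?_⟩
  have h := tendsto_pi_nhds.1 hzx n
  simp only [← hyz] at h
  exact h

variable [CompactSpace K]

/-- A sequence with the double limit property has a subsequence that converges pointwise to a
continuous function. -/
theorem exists_subseq_tendsto_of_hasDLP {A : Set C(K, ℝ)} {R : ℝ} (hR : ∀ f ∈ A, ∀ x, |f x| ≤ R)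
    (hA : HasDLP ((fun f : C(K, ℝ) => (f : K → ℝ)) '' A)) {f : ℕ → C(K, ℝ)} (hf : ∀ n, f n ∈ A) :
    ∃ (φ : ℕ → ℕ) (g : C(K, ℝ)), StrictMono φ ∧
      ∀ x, Tendsto (fun n => f (φ n) x) atTop (𝓝 (g x)) := by
  rw [hasDLP_image_iff] at hA
  rcases isEmpty_or_nonempty K with hK | hK
  · exact ⟨id, 0, strictMono_id, fun x => (hK.false x).elim⟩
  have hIcc : ∀ n x, f n x ∈ Set.Icc (-R) R := fun n x => abs_le.1 (hR _ (hf n) x)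
  -- a sequence of points that is dense with respect to the functions `f n`
  obtain ⟨d, hd⟩ : ∃ d : ℕ → K, ∀ x, (fun n => f n x) ∈
      closure ((fun y n => f n y) '' Set.range d) := by
    obtain ⟨c, hcs, hc, hcd⟩ := TopologicalSpace.IsSeparable.of_separableSpace
      (Set.range fun (y : K) (n : ℕ) => f n y) |>.exists_countable_dense_subset
    have hcn : c.Nonempty := by
      obtain ⟨x⟩ := hK
      exact closure_nonempty_iff.1 ⟨_, hcd ⟨x, rfl⟩⟩
    obtain ⟨e, rfl⟩ := hc.exists_eq_range hcn
    choose d hde using fun k => hcs ⟨k, rfl⟩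
    refine ⟨d, fun x => ?_⟩
    have : (fun (y : K) (n : ℕ) => f n y) '' Set.range d = Set.range e := by
      rw [← Set.range_comp]
      exact congrArg Set.range (funext hde)
    rw [this]
    exact hcd ⟨x, rfl⟩
  obtain ⟨w, -, φ, hφ, hφw⟩ := (isCompact_univ_pi fun _ : ℕ => isCompact_Icc (a := -R) (b := R)
    ).tendsto_subseq (x := fun n k => f n (d k)) fun n k _ => hIcc n (d k)
  have hw : ∀ k, Tendsto (fun n => f (φ n) (d k)) atTop (𝓝 (w k)) := tendsto_pi_nhds.1 hφw
  have hconv : ∀ x, ∃ t, Tendsto (fun n => f (φ n) x) atTop (𝓝 t) := by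
    intro x
    obtain ⟨y, hy, hyx⟩ := exists_seq_tendsto_of_mem_closure f (hd x)
    choose k hk using hy
    have hq : ∀ m, Tendsto (fun n => f (φ n) (y m)) atTop (𝓝 (w (k m))) := fun m => by
      rw [← hk]
      exact hw (k m)
    obtain ⟨t, -, ψ, hψ, hψt⟩ := (isCompact_Icc (a := -R) (b := R)).tendsto_subseq
      (x := fun m => w (k m)) fun m => isClosed_Icc.mem_of_tendsto (hq m)
        (Eventually.of_forall fun n => hIcc _ _)
    refine ⟨t, tendsto_of_subseq_tendsto fun ns hns => ?_⟩
    obtain ⟨s, -, ms, hms, hs⟩ := (isCompact_Icc (a := -R) (b := R)).tendsto_subseq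
      (x := fun n => f (φ (ns n)) x) fun n => hIcc _ _
    have hst : s = t := hA (fun n => f (φ (ns (ms n)))) (fun m => y (ψ m)) (fun n => hf _)
      (fun n => f (φ (ns (ms n))) x) (fun m => w (k (ψ m))) s t
      (fun n => (hyx _).comp hψ.tendsto_atTop) hs
      (fun m => (hq (ψ m)).comp (hns.comp hms.tendsto_atTop)) hψt
    exact ⟨ms, hst ▸ hs⟩
  choose g hg using hconv
  have hgIcc : ∀ x, g x ∈ Set.Icc (-R) R := fun x => isClosed_Icc.mem_of_tendsto (hg x)
    (Eventually.of_forall fun n => hIcc _ _)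
  have hgc : Continuous g := by
    refine continuous_iff_continuousAt.2 fun x => Metric.tendsto_nhds.2 fun ε hε => ?_
    by_contra hcon
    have hx : x ∈ closure {y | ¬ dist (g y) (g x) < ε} :=
      mem_closure_iff_frequently.2 (not_eventually.1 hcon)
    have hFc : Continuous fun (y : K) (n : ℕ) => f n y := continuous_pi fun n => (f n).continuous
    obtain ⟨y, hy, hyx⟩ := exists_seq_tendsto_of_mem_closure f
      (image_closure_subset_closure_image hFc ⟨x, hx, rfl⟩)
    obtain ⟨t, -, ψ, hψ, hψt⟩ := (isCompact_Icc (a := -R) (b := R)).tendsto_subseq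
      (x := fun m => g (y m)) fun m => hgIcc _
    have hst : g x = t := hA (fun n => f (φ n)) (fun m => y (ψ m)) (fun n => hf _)
      (fun n => f (φ n) x) (fun m => g (y (ψ m))) (g x) t
      (fun n => (hyx _).comp hψ.tendsto_atTop) (hg x) (fun m => hg _) hψt
    obtain ⟨m, hm⟩ := (Metric.tendsto_nhds.1 hψt ε hε).exists
    exact hy (ψ m) (hst ▸ hm)
  exact ⟨φ, ⟨g, hgc⟩, hφ, hg⟩

/-- Grothendieck's theorem: by dominated convergence, the double limit property on `K` gives weak
sequential compactness in `C(K)`, hence the double limit property on the dual ball. -/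
theorem isPolarlyCompatible_dlpClass : IsPolarlyCompatible dlpClass.{u} := by
  intro K _ _ _ A hA
  refine ⟨isBounded_image_restr_dualBall hA.1, hasDLP_image_iff.2 ?_⟩
  intro f ν hf p q s t hp hps hq hqt
  choose g hg hgf using hf
  obtain rfl : (fun n => restr (dualBall C(K, ℝ)) (g n)) = f := funext hgf
  replace hp : ∀ n, Tendsto (fun m => (ν m : WeakDual ℝ C(K, ℝ)) (g n)) atTop (𝓝 (p n)) := hp
  replace hq : ∀ m, Tendsto (fun n => (ν m : WeakDual ℝ C(K, ℝ)) (g n)) atTop (𝓝 (q m)) := hq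
  obtain ⟨R, hR⟩ := isBounded_iff_pointwise.1 hA.1
  obtain ⟨φ, k, hφ, hk⟩ := exists_subseq_tendsto_of_hasDLP hR hA.2 hg
  have hweak : ∀ ξ : StrongDual ℝ C(K, ℝ),
      Tendsto (fun n => ξ (g (φ n))) atTop (𝓝 (ξ k)) := fun ξ => by
    obtain ⟨c, hc, hc'⟩ := exists_tendsto_apply_of_tendsto_pointwise ξ
      (fun n => hR _ (hg (φ n))) hk
    rwa [hc' k fun x => rfl]
  -- a weak-star cluster point of the functionals `ν m`
  let U : Ultrafilter ℕ := hyperfilter ℕ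
  have hU : (U : Filter ℕ) ≤ atTop := Nat.hyperfilter_le_atTop
  obtain ⟨ξ, hξ⟩ : ∃ ξ, Tendsto ν U (𝓝 ξ) := by
    obtain ⟨ξ, -, hξ⟩ := isCompact_univ.ultrafilter_le_nhds (U.map ν) (by simp)
    exact ⟨ξ, hξ⟩
  have hξe : ∀ h : C(K, ℝ), Tendsto (fun m => (ν m : WeakDual ℝ C(K, ℝ)) h) U
      (𝓝 ((ξ : WeakDual ℝ C(K, ℝ)) h)) := fun h =>
    (((WeakDual.eval_continuous h).comp continuous_subtype_val).tendsto ξ).comp hξ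
  have h1 : ∀ n, p n = (ξ : WeakDual ℝ C(K, ℝ)) (g n) := fun n =>
    tendsto_nhds_unique ((hp n).mono_left hU) (hξe (g n))
  have h2 : ∀ m, q m = (ν m : WeakDual ℝ C(K, ℝ)) k := fun m =>
    tendsto_nhds_unique ((hq m).comp hφ.tendsto_atTop) (hweak (WeakDual.toStrongDual (ν m).1))
  have h3 : s = (ξ : WeakDual ℝ C(K, ℝ)) k := by
    refine tendsto_nhds_unique (hps.comp hφ.tendsto_atTop) ?_
    have := hweak (WeakDual.toStrongDual ξ.1)
    exact this.congr fun n => (h1 (φ n)).symm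
  rw [h3]
  refine tendsto_nhds_unique ?_ (hqt.mono_left hU)
  rw [show q = fun m => (ν m : WeakDual ℝ C(K, ℝ)) k from funext h2]
  exact hξe k

end DLP

/-! ### Fragmented families -/

section Fragmented

/-- Fragmentation descends along continuous surjections of compact spaces: on a minimal closed set
that is mapped onto the closure of `S`, images of open sets have interior points. -/
theorem IsFragmentedFamily.of_comp {K₁ K₂ : Type u} [TopologicalSpace K₁] [CompactSpace K₁]
    [TopologicalSpace K₂] [T2Space K₂] {p : K₁ → K₂} (hpc : Continuous p)
    (hp : Function.Surjective p) {F : Set (K₂ → ℝ)}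
    (hF : IsFragmentedFamily ((fun f => f ∘ p) '' F)) : IsFragmentedFamily F := by
  intro S hS ε hε
  set C := closure S with hC
  have hDc : CompactSpace (p ⁻¹' C) :=
    isCompact_iff_compactSpace.1 (isClosed_closure.preimage hpc).isCompact
  let π : p ⁻¹' C → C := fun x => ⟨p x.1, x.2⟩
  have hπc : Continuous π := (hpc.comp continuous_subtype_val).subtype_mk _
  have hπs : Function.Surjective π := fun y => by
    obtain ⟨x, hx⟩ := hp y.1
    exact ⟨⟨x, by simp [hx]⟩, Subtype.ext hx⟩
  obtain ⟨E, hEc, hE, hmin⟩ := exists_compact_surjective_zorn_subset hπc hπs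
  obtain ⟨y₀, hy₀⟩ := hS
  have hEne : (Subtype.val '' E : Set K₁).Nonempty := by
    obtain ⟨x, hx, -⟩ : (⟨y₀, subset_closure hy₀⟩ : C) ∈ π '' E := hE ▸ Set.mem_univ _
    exact ⟨_, x, hx, rfl⟩
  obtain ⟨O, hO, ⟨_, hzO, z, hzE, rfl⟩, hOF⟩ := hF _ hEne ε hε
  let E₀ : Set E := {x | (x.1.1 : K₁) ∉ O}
  have hE₀c : IsClosed E₀ :=
    (hO.preimage (continuous_subtype_val.comp continuous_subtype_val)).isClosed_compl
  have hE₀ : E₀ ≠ Set.univ := fun h => (h ▸ Set.mem_univ (⟨z, hzE⟩ : E) : (⟨z, hzE⟩ : E) ∈ E₀) hzO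
  have hne := hmin E₀ hE₀ hE₀c
  have hcl : IsClosed (E.domRestrict π '' E₀) :=
    (hE₀c.isCompact.image (hπc.comp continuous_subtype_val)).isClosed
  obtain ⟨V, hV, hVC⟩ := isOpen_induced_iff.1 hcl.isOpen_compl
  obtain ⟨w, hw⟩ := (Set.ne_univ_iff_exists_notMem _).1 hne
  have hwV : w.1 ∈ V := by
    have : w ∈ Subtype.val ⁻¹' V := hVC ▸ hw
    exact this
  -- points of `V ∩ S` are images of points of `O ∩ E`
  have hlift : ∀ y ∈ V ∩ S, ∃ x ∈ O ∩ (Subtype.val '' E : Set K₁), p x = y := by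
    intro y hy
    have hyC : y ∈ C := subset_closure hy.2
    obtain ⟨x, hx, hxy⟩ : (⟨y, hyC⟩ : C) ∈ π '' E := hE ▸ Set.mem_univ _
    refine ⟨x.1, ⟨?_, x, hx, rfl⟩, congrArg Subtype.val hxy⟩
    by_contra hxO
    have h1 : (⟨y, hyC⟩ : C) ∈ (E.domRestrict π '' E₀)ᶜ := by
      rw [← hVC]
      exact hy.1
    exact h1 ⟨⟨x, hx⟩, hxO, hxy⟩
  refine ⟨V, hV, mem_closure_iff.1 w.2 V hV hwV, fun f hf y hy y' hy' => ?_⟩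
  obtain ⟨x, hx, rfl⟩ := hlift y hy
  obtain ⟨x', hx', rfl⟩ := hlift y' hy'
  exact hOF _ ⟨f, hf, rfl⟩ x hx x' hx'

theorem IsFragmentedFamily.comp {K₁ K₂ : Type*} [TopologicalSpace K₁] [TopologicalSpace K₂]
    {p : K₁ → K₂} (hpc : Continuous p) {F : Set (K₂ → ℝ)} (hF : IsFragmentedFamily F) :
    IsFragmentedFamily ((fun f => f ∘ p) '' F) := by
  intro S hS ε hε
  obtain ⟨O, hO, ⟨_, hzO, z, hz, rfl⟩, hOF⟩ := hF (p '' S) (hS.image p) ε hε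
  refine ⟨p ⁻¹' O, hO.preimage hpc, ⟨z, hzO, hz⟩, ?_⟩
  rintro _ ⟨f, hf, rfl⟩ x hx y hy
  exact hOF f hf _ ⟨hx.1, x, hx.2, rfl⟩ _ ⟨hy.1, y, hy.2, rfl⟩

theorem IsFragmentedFamily.mono {X : Type*} [TopologicalSpace X] {F F' : Set (X → ℝ)}
    (hF : IsFragmentedFamily F) (h : F' ⊆ F) : IsFragmentedFamily F' := by
  intro S hS ε hε
  obtain ⟨O, hO, hOS, hOF⟩ := hF S hS ε hε
  exact ⟨O, hO, hOS, fun f hf => hOF f (h hf)⟩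

theorem image_image_comp {K₁ K₂ : Type*} [TopologicalSpace K₁] [TopologicalSpace K₂]
    (p : C(K₁, K₂)) (A : Set C(K₂, ℝ)) :
    (fun f : C(K₁, ℝ) => (f : K₁ → ℝ)) '' ((fun f : C(K₂, ℝ) => f.comp p) '' A) =
      (fun f => f ∘ p) '' ((fun f : C(K₂, ℝ) => (f : K₂ → ℝ)) '' A) := by
  rw [Set.image_image, Set.image_image]
  rfl

theorem comp_mem_npClass (K₁ K₂ : Type u) [TopologicalSpace K₁] [CompactSpace K₁] [T2Space K₁]
    [TopologicalSpace K₂] [CompactSpace K₂] [T2Space K₂] (p : C(K₁, K₂)) (A : Set C(K₂, ℝ))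
    (hA : A ∈ npClass K₂) : (fun f : C(K₂, ℝ) => f.comp p) '' A ∈ npClass K₁ :=
  ⟨isBounded_image_comp p hA.1, image_image_comp p A ▸ hA.2.comp p.continuous⟩

theorem mem_npClass_of_comp (K₁ K₂ : Type u) [TopologicalSpace K₁] [CompactSpace K₁] [T2Space K₁]
    [TopologicalSpace K₂] [CompactSpace K₂] [T2Space K₂] (p : C(K₁, K₂)) (A : Set C(K₂, ℝ))
    (hp : Function.Surjective p) (hA : (fun f : C(K₂, ℝ) => f.comp p) '' A ∈ npClass K₁) :
    A ∈ npClass K₂ := by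
  refine ⟨isBounded_of_image_comp p hp hA.1, IsFragmentedFamily.of_comp p.continuous hp ?_⟩
  rw [← image_image_comp]
  exact hA.2

/-- A fragmented family on a second countable space has countable uniform nets. -/
theorem IsFragmentedFamily.exists_countable_net {X : Type*} [TopologicalSpace X]
    [SecondCountableTopology X] {F : Set (X → ℝ)} (hF : IsFragmentedFamily F) {ε : ℝ}
    (hε : 0 < ε) : ∃ Z : Set X, Z.Countable ∧ ∀ x, ∃ z ∈ Z, ∀ f ∈ F, |f x - f z| ≤ ε := by
  let HasNet : Set X → Prop := fun V =>
    ∃ Z : Set X, Z.Countable ∧ ∀ x ∈ V, ∃ z ∈ Z, ∀ f ∈ F, |f x - f z| ≤ ε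
  -- the largest open set with a countable net
  obtain ⟨T, hTc, hTs, hTu⟩ := TopologicalSpace.isOpen_sUnion_countable
    {V : Set X | IsOpen V ∧ HasNet V} fun V hV => hV.1
  have hWnet : HasNet (⋃₀ T) := by
    choose! Z hZc hZ using fun V (hV : V ∈ T) => (hTs hV).2
    refine ⟨⋃ V ∈ T, Z V, hTc.biUnion hZc, ?_⟩
    rintro x ⟨V, hV, hx⟩
    obtain ⟨z, hz, h⟩ := hZ V hV x hx
    exact ⟨z, Set.mem_biUnion hV hz, h⟩
  have hWo : IsOpen (⋃₀ T) := isOpen_sUnion fun V hV => (hTs hV).1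
  by_cases hS : (⋃₀ T)ᶜ.Nonempty
  · exfalso
    obtain ⟨O, hO, ⟨z, hzO, hz⟩, hOF⟩ := hF _ hS ε hε
    have hnet : HasNet O := by
      obtain ⟨Z, hZc, hZ⟩ := hWnet
      refine ⟨insert z Z, hZc.insert z, fun x hx => ?_⟩
      by_cases hxW : x ∈ ⋃₀ T
      · obtain ⟨y, hy, h⟩ := hZ x hxW
        exact ⟨y, Or.inr hy, h⟩
      · exact ⟨z, Or.inl rfl, fun f hf => (hOF f hf x ⟨hx, hxW⟩ z ⟨hzO, hz⟩).le⟩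
    refine hz ?_
    rw [hTu]
    exact ⟨O, ⟨hO, hnet⟩, hzO⟩
  · obtain ⟨Z, hZc, hZ⟩ := hWnet
    refine ⟨Z, hZc, fun x => hZ x ?_⟩
    by_contra hx
    exact hS ⟨x, hx⟩

/-- A sequence in a fragmented family has countable uniform nets: it factors through the metrizable
image of `K` in `ℝ^ℕ`. -/
theorem exists_countable_net_of_sequence {K : Type u} [TopologicalSpace K] [CompactSpace K]
    {A : Set C(K, ℝ)}
    (hA : IsFragmentedFamily ((fun f : C(K, ℝ) => (f : K → ℝ)) '' A)) {f : ℕ → C(K, ℝ)}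
    (hf : ∀ n, f n ∈ A) {ε : ℝ} (hε : 0 < ε) :
    ∃ Z : Set K, Z.Countable ∧ ∀ x, ∃ z ∈ Z, ∀ n, |f n x - f n z| ≤ ε := by
  -- the index type is lifted to have the image in the universe of `K`
  let Φ : K → ULift.{u} ℕ → ℝ := fun x n => f n.down x
  have hΦ : Continuous Φ := continuous_pi fun n => (f n.down).continuous
  let F : Set (Set.range Φ → ℝ) := Set.range fun (n : ULift.{u} ℕ) (y : Set.range Φ) => y.1 n
  have hF : IsFragmentedFamily F := by
    refine IsFragmentedFamily.of_comp (hΦ.subtype_mk fun x => ⟨x, rfl⟩)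
      Set.rangeFactorization_surjective (hA.mono ?_)
    rintro _ ⟨_, ⟨n, rfl⟩, rfl⟩
    exact ⟨f n.down, hf n.down, rfl⟩
  obtain ⟨Z, hZc, hZ⟩ := hF.exists_countable_net hε
  choose g hg using fun y : Set.range Φ => y.2
  refine ⟨g '' Z, hZc.image g, fun x => ?_⟩
  obtain ⟨z, hz, h⟩ := hZ ⟨Φ x, x, rfl⟩
  refine ⟨g z, ⟨z, hz, rfl⟩, fun n => ?_⟩
  have h1 := h _ ⟨⟨n⟩, rfl⟩
  have h2 : f n (g z) = z.1 ⟨n⟩ := congrFun (hg z) ⟨n⟩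
  rw [h2]
  exact h1

section NonFragmented

variable {X : Type*} [TopologicalSpace X] [CompactSpace X] [T2Space X]

/-- One step of the Cantor scheme for a family that is not fragmented. -/
theorem exists_split_of_not_small {A : Set C(X, ℝ)} {S : Set X} {ε : ℝ} (hε : 0 < ε)
    (h : ∀ O : Set X, IsOpen O → (O ∩ S).Nonempty →
      ∃ f ∈ A, ∃ x ∈ O ∩ S, ∃ y ∈ O ∩ S, ε ≤ |f x - f y|)
    {O : Set X} (hO : IsOpen O) (hOS : (O ∩ S).Nonempty) :
    ∃ f ∈ A, ∃ W : Bool → Set X, (∀ b, IsOpen (W b) ∧ (W b ∩ S).Nonempty ∧ closure (W b) ⊆ O) ∧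
      ∀ x ∈ closure (W true), ∀ y ∈ closure (W false), ε / 2 ≤ |f x - f y| := by
  obtain ⟨f, hf, x, hx, y, hy, hxy⟩ := h O hO hOS
  have hW : ∀ z ∈ O ∩ S, ∃ W : Set X, IsOpen W ∧ (W ∩ S).Nonempty ∧ closure W ⊆ O ∧
      ∀ w ∈ closure W, |f w - f z| ≤ ε / 4 := by
    intro z hz
    have hN : O ∩ {w | |f w - f z| ≤ ε / 4} ∈ 𝓝 z := by
      refine inter_mem (hO.mem_nhds hz.1) ?_
      filter_upwards [Metric.tendsto_nhds.1 f.continuous.continuousAt (ε / 4) (by positivity)]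
        with w hw
      exact (Real.dist_eq _ _ ▸ hw).le
    obtain ⟨N, hN, hNc, hNs⟩ := exists_mem_nhds_isClosed_subset hN
    have hcl : closure (interior N) ⊆ N := closure_minimal interior_subset hNc
    exact ⟨interior N, isOpen_interior, ⟨z, mem_interior_iff_mem_nhds.2 hN, hz.2⟩,
      fun w hw => (hNs (hcl hw)).1, fun w hw => (hNs (hcl hw)).2⟩
  obtain ⟨W₁, h₁, h₁', h₁'', h₁f⟩ := hW x hx
  obtain ⟨W₂, h₂, h₂', h₂'', h₂f⟩ := hW y hy
  refine ⟨f, hf, fun b => if b then W₁ else W₂, ?_, fun u hu v hv => ?_⟩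
  · rintro (_ | _)
    · exact ⟨h₂, h₂', h₂''⟩
    · exact ⟨h₁, h₁', h₁''⟩
  · have e1 := abs_le.1 (h₁f u hu)
    have e2 := abs_le.1 (h₂f v hv)
    rcases le_total 0 (f x - f y) with h0 | h0
    · rw [abs_of_nonneg h0] at hxy
      exact le_trans (by linarith) (le_abs_self _)
    · rw [abs_of_nonpos h0] at hxy
      exact le_trans (by linarith) (neg_le_abs _)

/-- The initial segments of a branch, most recent entry first. -/
def branchPrefix (β : ℕ → Bool) : ℕ → List Bool
  | 0 => []
  | k + 1 => β k :: branchPrefix β k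

theorem branchPrefix_congr {β β' : ℕ → Bool} {k : ℕ} (h : ∀ i < k, β i = β' i) :
    branchPrefix β k = branchPrefix β' k := by
  induction k with
  | zero => rfl
  | succ k ih =>
    rw [branchPrefix, branchPrefix, ih fun i hi => h i (hi.trans k.lt_succ_self),
      h k k.lt_succ_self]

/-- A family of continuous functions that is not fragmented contains a sequence for which there is a
uniformly separated set of points indexed by the Cantor set. -/
theorem exists_cantor_separated {A : Set C(X, ℝ)}
    (hA : ¬ IsFragmentedFamily ((fun f : C(X, ℝ) => (f : X → ℝ)) '' A)) :
    ∃ ε > 0, ∃ f : ℕ → C(X, ℝ), (∀ n, f n ∈ A) ∧ ∃ x : (ℕ → Bool) → X,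
      ∀ β β', β ≠ β' → ∃ n, ε ≤ |f n (x β) - f n (x β')| := by
  simp only [IsFragmentedFamily, not_forall] at hA
  obtain ⟨S, hS, ε, hε, hA⟩ := hA
  have h : ∀ O : Set X, IsOpen O → (O ∩ S).Nonempty →
      ∃ f ∈ A, ∃ x ∈ O ∩ S, ∃ y ∈ O ∩ S, ε ≤ |f x - f y| := by
    intro O hO hOS
    by_contra hcon
    push Not at hcon
    refine hA ⟨O, hO, hOS, ?_⟩
    rintro _ ⟨f, hf, rfl⟩ x hx y hy
    exact hcon f hf x hx y hy
  let Node := {O : Set X // IsOpen O ∧ (O ∩ S).Nonempty}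
  choose g hg W hW hWg using fun O : Node => exists_split_of_not_small hε h O.2.1 O.2.2
  let node : List Bool → Node := fun l => l.rec ⟨Set.univ, isOpen_univ, by simpa using hS⟩
    fun b _ O => ⟨W O b, (hW O b).1, (hW O b).2.1⟩
  have hnode : ∀ b l, (node (b :: l)).1 = W (node l) b := fun b l => rfl
  have hbranch : ∀ β : ℕ → Bool, ∃ x, ∀ k, x ∈ closure (node (branchPrefix β k)).1 := by
    intro β
    have := IsCompact.nonempty_iInter_of_sequence_nonempty_isCompact_isClosed
      (fun k => closure (node (branchPrefix β k)).1)
      (fun k => ((hW (node (branchPrefix β k)) (β k)).2.2).trans subset_closure)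
      (fun k => ((node (branchPrefix β k)).2.2.mono Set.inter_subset_left).closure)
      isClosed_closure.isCompact (fun k => isClosed_closure)
    obtain ⟨x, hx⟩ := this
    exact ⟨x, fun k => Set.mem_iInter.1 hx k⟩
  choose x hx using hbranch
  obtain ⟨e, he⟩ := exists_surjective_nat (List Bool)
  refine ⟨ε / 2, half_pos hε, fun n => g (node (e n)), fun n => hg _, x, fun β β' hβ => ?_⟩
  have hex : ∃ k, β k ≠ β' k := Function.ne_iff.1 hβ
  classical
  have hpre := branchPrefix_congr (β := β) (β' := β') (k := Nat.find hex) fun i hi =>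
    not_not.1 (Nat.find_min hex hi)
  have hk := Nat.find_spec hex
  set k := Nat.find hex
  obtain ⟨n, hn⟩ := he (branchPrefix β k)
  refine ⟨n, ?_⟩
  beta_reduce
  rw [hn]
  have h1 := hx β (k + 1)
  have h2 := hx β' (k + 1)
  rw [branchPrefix, hnode] at h1 h2
  rw [← hpre] at h2
  cases hb : β k <;> cases hb' : β' k <;> rw [hb] at h1 hk <;> rw [hb'] at h2 hk
  · exact (hk rfl).elim
  · rw [abs_sub_comm]
    exact hWg _ _ h2 _ h1
  · exact hWg _ _ h1 _ h2
  · exact (hk rfl).elim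

end NonFragmented

section Approximation

variable {K : Type u} [TopologicalSpace K] [CompactSpace K] [T2Space K]

/-- The values of a functional on the members of a bounded sequence. -/
noncomputable def evalSequence (f : ℕ → C(K, ℝ)) (R : ℝ) (hR : ∀ n, ‖f n‖ ≤ R)
    (ν : StrongDual ℝ C(K, ℝ)) : ℕ →ᵇ ℝ :=
  BoundedContinuousFunction.ofNormedAddCommGroup (fun n => ν (f n))
    continuous_of_discreteTopology (‖ν‖ * R) fun n => ν.le_opNorm_of_le (hR n)

/-- If the points of `K` have countable uniform nets with respect to a bounded sequence in `C(K)`,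
then integrals are uniformly approximated by finite combinations of point evaluations from a
countable set: `K` is cut into countably many measurable pieces on which all members of the
sequence have small oscillation. -/
theorem exists_finset_approx_integral [MeasurableSpace K] [BorelSpace K] (m : Measure K)
    [IsFiniteMeasure m] {f : ℕ → C(K, ℝ)} {R : ℝ} (hR : ∀ n x, |f n x| ≤ R)
    {z : ℕ → K} {ε : ℝ} (hz : ∀ x, ∃ i, ∀ n, |f n x - f n (z i)| ≤ ε) {δ : ℝ} (hδ : 0 < δ)
    (hεδ : ε * m.real Set.univ ≤ δ) :
    ∃ (N : ℕ) (c : ℕ → ℝ), ∀ n,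
      |∫ x, f n x ∂m - ∑ i ∈ Finset.range N, c i * f n (z i)| ≤ 2 * δ := by
  classical
  have hε0 : ∀ x : K, 0 ≤ ε := fun x => (hz x).elim fun i hi => (abs_nonneg _).trans (hi 0)
  let idx : K → ℕ := fun x => Nat.find (hz x)
  have hidx : ∀ x n, |f n x - f n (z (idx x))| ≤ ε := fun x => Nat.find_spec (hz x)
  have hmeas : Measurable idx := by
    refine measurable_find hz fun i => ?_
    simp only [Set.ofPred_forall]
    refine MeasurableSet.iInter fun n => ?_
    exact (isClosed_le ((f n).continuous.sub continuous_const).abs continuous_const).measurableSet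
  let D : ℕ → Set K := fun i => idx ⁻¹' {i}
  have hD : ∀ i, MeasurableSet (D i) := fun i => hmeas (measurableSet_singleton i)
  let T : ℕ → Set K := fun N => ⋃ i ∈ Finset.range N, D i
  have hT : ∀ N, MeasurableSet (T N) := fun N =>
    Finset.measurableSet_biUnion _ fun i _ => hD i
  have hint : ∀ n, Integrable (f n) m := fun n =>
    (f n).continuous.integrable_of_hasCompactSupport (HasCompactSupport.of_compactSpace _)
  -- the remainder has small measure
  obtain ⟨N, hN⟩ : ∃ N, R * m.real (T N)ᶜ ≤ δ := by
    have hlim : Tendsto (fun N => m.real (T N)ᶜ) atTop (𝓝 0) := by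
      have hTc : ∀ N, (T N)ᶜ = {x | N ≤ idx x} := fun N => by
        ext x
        simp only [T, D, Set.mem_compl_iff, Set.mem_iUnion, Finset.mem_range, Set.mem_preimage,
          Set.mem_singleton_iff, exists_prop, exists_eq_right', not_lt, Set.mem_ofPred_eq]
      have hanti : Antitone fun N => (T N)ᶜ := fun N N' h => by
        simp only [hTc]
        exact fun x hx => h.trans hx
      have hinter : ⋂ N, (T N)ᶜ = ∅ := by
        refine Set.eq_empty_of_forall_notMem fun x hx => ?_
        have h1 := Set.mem_iInter.1 hx (idx x + 1)
        rw [hTc] at h1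
        exact Nat.not_succ_le_self _ h1
      have h1 := tendsto_measure_iInter_atTop (μ := m)
        (fun N => (hT N).compl.nullMeasurableSet) hanti ⟨0, measure_ne_top _ _⟩
      rw [hinter, measure_empty] at h1
      exact (ENNReal.tendsto_toReal ENNReal.zero_ne_top).comp h1
    have := hlim.const_mul R
    rw [mul_zero] at this
    exact ((tendsto_order.1 this).2 δ hδ).exists.imp fun N h => h.le
  have hdisj : (Finset.range N : Set ℕ).PairwiseDisjoint D := fun i _ j _ hij =>
    Set.disjoint_left.2 fun x hx hx' => hij (hx.symm.trans hx')
  refine ⟨N, fun i => m.real (D i), fun n => ?_⟩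
  have hsplit : ∫ x, f n x ∂m =
      ∑ i ∈ Finset.range N, ∫ x in D i, f n x ∂m + ∫ x in (T N)ᶜ, f n x ∂m := by
    rw [← integral_biUnion_finset _ (fun i _ => hD i) hdisj fun i _ => (hint n).integrableOn]
    exact (integral_add_compl (hT N) (hint n)).symm
  have hpiece : ∀ i, |∫ x in D i, f n x ∂m - m.real (D i) * f n (z i)| ≤ ε * m.real (D i) := by
    intro i
    have h1 : m.real (D i) * f n (z i) = ∫ x in D i, f n (z i) ∂m := by
      rw [setIntegral_const, smul_eq_mul]
    rw [h1, ← integral_sub (hint n).integrableOn (integrable_const _)]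
    refine norm_setIntegral_le_of_norm_le_const (f := fun x => f n x - f n (z i))
      (measure_lt_top _ _) fun x hx => ?_
    have := hidx x n
    rwa [show idx x = i from hx] at this
  have hrest : |∫ x in (T N)ᶜ, f n x ∂m| ≤ R * m.real (T N)ᶜ :=
    norm_setIntegral_le_of_norm_le_const (f := f n) (measure_lt_top _ _) fun x _ => hR n x
  have hsum : ∑ i ∈ Finset.range N, m.real (D i) ≤ m.real Set.univ := by
    rw [← measureReal_biUnion_finset hdisj fun i _ => hD i]
    exact measureReal_mono (Set.subset_univ _)
  have hmain : |∑ i ∈ Finset.range N, (∫ x in D i, f n x ∂m - m.real (D i) * f n (z i))| ≤ δ := by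
    refine (Finset.abs_sum_le_sum_abs _ _).trans
      ((Finset.sum_le_sum fun i _ => hpiece i).trans ?_)
    rw [← Finset.mul_sum]
    rcases isEmpty_or_nonempty K with hK | ⟨⟨x⟩⟩
    · have : ∀ s : Set K, m.real s = 0 := fun s => by
        rw [Set.eq_empty_of_isEmpty s, measureReal_empty]
      simp [this, hδ.le]
    · exact (mul_le_mul_of_nonneg_left hsum (hε0 x)).trans hεδ
  rw [hsplit, add_sub_right_comm, ← Finset.sum_sub_distrib]
  exact (abs_add_le _ _).trans (by linarith)

/-- The values on a sequence from a fragmented family of all functionals on `C(K)` form a norm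
separable set of bounded sequences. -/
theorem isSeparable_range_evalSequence {A : Set C(K, ℝ)}
    (hA : IsFragmentedFamily ((fun f : C(K, ℝ) => (f : K → ℝ)) '' A)) {f : ℕ → C(K, ℝ)}
    (hf : ∀ n, f n ∈ A) (R : ℝ) (hR : ∀ n, ‖f n‖ ≤ R) :
    TopologicalSpace.IsSeparable (Set.range (evalSequence f R hR)) := by
  rcases isEmpty_or_nonempty K with hK | hK
  · refine (Set.countable_singleton (0 : ℕ →ᵇ ℝ)).isSeparable.mono ?_
    rintro _ ⟨ν, rfl⟩
    refine BoundedContinuousFunction.ext fun n => ?_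
    change ν (f n) = 0
    rw [show f n = 0 from ContinuousMap.ext fun x => (hK.false x).elim, map_zero]
  have hnet : ∀ k : ℕ, ∃ z : ℕ → K, ∀ x, ∃ i, ∀ n, |f n x - f n (z i)| ≤ 1 / ((k : ℝ) + 1) := by
    intro k
    obtain ⟨Z, hZc, hZ⟩ := exists_countable_net_of_sequence hA hf
      (Nat.one_div_pos_of_nat (α := ℝ) (n := k))
    have hZn : Z.Nonempty := hK.elim fun x => (hZ x).imp fun z hz => hz.1
    obtain ⟨z, rfl⟩ := hZc.exists_eq_range hZn
    refine ⟨z, fun x => ?_⟩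
    obtain ⟨_, ⟨i, rfl⟩, h⟩ := hZ x
    exact ⟨i, h⟩
  choose z hz using hnet
  let e : ℕ × ℕ → (ℕ →ᵇ ℝ) := fun p => evalSequence f R hR (ContinuousMap.evalCLM ℝ (z p.1 p.2))
  refine (Set.countable_range e).isSeparable.span (R := ℝ) |>.closure.mono ?_
  rintro _ ⟨ν, rfl⟩
  refine Metric.mem_closure_iff.2 fun ε hε => ?_
  borelize K
  obtain ⟨m₁, m₂, hm₁, hm₂, hν⟩ := exists_measures_eq_sub_integral ν
  obtain ⟨k, hk⟩ := exists_nat_one_div_lt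
    (show 0 < ε / 8 / (m₁.real Set.univ + m₂.real Set.univ + 1) by positivity)
  rw [lt_div_iff₀ (by positivity)] at hk
  have hk0 : (0 : ℝ) < 1 / ((k : ℝ) + 1) := Nat.one_div_pos_of_nat
  have hRx : ∀ n x, |f n x| ≤ R := fun n x => ((f n).norm_coe_le_norm x).trans (hR n)
  have hm₁0 : 0 ≤ m₁.real Set.univ := measureReal_nonneg
  have hm₂0 : 0 ≤ m₂.real Set.univ := measureReal_nonneg
  obtain ⟨N₁, c₁, h₁⟩ := exists_finset_approx_integral m₁ hRx (hz k)
    (show 0 < ε / 8 by positivity) (by nlinarith)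
  obtain ⟨N₂, c₂, h₂⟩ := exists_finset_approx_integral m₂ hRx (hz k)
    (show 0 < ε / 8 by positivity) (by nlinarith)
  have hmem : ∀ i, e (k, i) ∈ Submodule.span ℝ (Set.range e) := fun i =>
    Submodule.subset_span ⟨_, rfl⟩
  refine ⟨∑ i ∈ Finset.range N₁, c₁ i • e (k, i) - ∑ i ∈ Finset.range N₂, c₂ i • e (k, i),
    Submodule.sub_mem _ (Submodule.sum_mem _ fun i _ => Submodule.smul_mem _ _ (hmem i))
      (Submodule.sum_mem _ fun i _ => Submodule.smul_mem _ _ (hmem i)), ?_⟩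
  refine lt_of_le_of_lt ((BoundedContinuousFunction.dist_le (half_pos hε).le).2 fun n => ?_)
    (half_lt_self hε)
  have hval : ∀ (N : ℕ) (c : ℕ → ℝ), (∑ i ∈ Finset.range N, c i • e (k, i)) n =
      ∑ i ∈ Finset.range N, c i * f n (z k i) := fun N c => by
    rw [BoundedContinuousFunction.coe_sum, Finset.sum_apply]
    rfl
  rw [Real.dist_eq, BoundedContinuousFunction.sub_apply, hval, hval]
  change |ν (f n) - _| ≤ _
  rw [hν]
  have a₁ := abs_le.1 (h₁ n)
  have a₂ := abs_le.1 (h₂ n)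
  rw [abs_le]
  constructor <;> linarith

/-- Fragmentation passes from `K` to the dual ball of `C(K)`: otherwise some sequence of the family
would separate, uniformly, the points of a Cantor set of functionals. -/
theorem isPolarlyCompatible_npClass : IsPolarlyCompatible npClass.{u} := by
  intro K _ _ _ A hA
  refine ⟨isBounded_image_restr_dualBall hA.1, ?_⟩
  by_contra hcon
  obtain ⟨ε, hε, f, hf, x, hx⟩ := exists_cantor_separated hcon
  choose g hg hgf using hf
  obtain rfl : (fun n => restr (dualBall C(K, ℝ)) (g n)) = f := funext hgf
  obtain ⟨R, hR⟩ := isBounded_iff_forall_norm_le.1 hA.1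
  have hR' : ∀ n, ‖g n‖ ≤ R := fun n => hR _ (hg n)
  obtain ⟨c, hc, hcd⟩ := isSeparable_range_evalSequence hA.2 hg R hR'
  let J : (ℕ → Bool) → (ℕ →ᵇ ℝ) := fun β =>
    evalSequence g R hR' (WeakDual.toStrongDual (x β).1)
  have hJ : ∀ β β', β ≠ β' → ε ≤ dist (J β) (J β') := fun β β' h => by
    obtain ⟨n, hn⟩ := hx β β' h
    exact hn.trans ((Real.dist_eq _ _).symm.le.trans
      (BoundedContinuousFunction.dist_coe_le_dist (f := J β) (g := J β') n))
  choose y hyc hy using fun β =>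
    Metric.mem_closure_iff.1 (hcd ⟨WeakDual.toStrongDual (x β).1, rfl⟩ : J β ∈ closure c)
      (ε / 2) (half_pos hε)
  have hinj : Function.Injective fun β => (⟨y β, hyc β⟩ : c) := by
    intro β β' h
    by_contra hne
    have h1 := hJ β β' hne
    have h2 := dist_triangle_right (J β) (J β') (y β)
    have h3 := hy β
    have h4 := hy β'
    rw [← show y β = y β' from congrArg Subtype.val h] at h4
    linarith
  have := hc.to_subtype
  have hcount : Countable (ℕ → Bool) := hinj.countable
  obtain ⟨e, he⟩ := exists_surjective_nat (ℕ → Bool)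
  obtain ⟨n, hn⟩ := he fun n => !(e n n)
  simpa using congrFun hn n

end Approximation

end Fragmented

/-! ### Tame families -/

section Rosenthal

/-- Suppose that for every state `s` that satisfies an invariant, the set `G s` of admissible moves
belongs to a nonprincipal ultrafilter and admissible moves preserve the invariant. Then there is an
increasing sequence of moves such that all its finite subsequences can be played from `s₀`. Here
`Q k` contains the states that can be reached by playing some of the first `k` moves. -/
theorem exists_generic_sequence {α : Type*} (U : Ultrafilter ℕ) (hU : (U : Filter ℕ) ≤ atTop)
    (G : α → Set ℕ) (step : α → ℕ → α) (Inv : α → Prop) (hG : ∀ s, Inv s → G s ∈ U)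
    (hstep : ∀ s, Inv s → ∀ n ∈ G s, Inv (step s n)) (s₀ : α) (hs₀ : Inv s₀) :
    ∃ (e : ℕ → ℕ) (Q : ℕ → Set α), StrictMono e ∧ s₀ ∈ Q 0 ∧ ∀ k, ∀ s ∈ Q k,
      Inv s ∧ e k ∈ G s ∧ s ∈ Q (k + 1) ∧ step s (e k) ∈ Q (k + 1) := by
  let Stage := {p : Set α × ℕ // p.1.Finite ∧ ∀ s ∈ p.1, Inv s}
  have hnext : ∀ p : Stage, ∃ n, p.1.2 < n ∧ ∀ s ∈ p.1.1, n ∈ G s := by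
    intro p
    have h1 : {n | p.1.2 < n} ∩ ⋂ s ∈ p.1.1, G s ∈ U :=
      inter_mem (hU (Ioi_mem_atTop _)) ((biInter_mem p.2.1).2 fun s hs => hG s (p.2.2 s hs))
    obtain ⟨n, hn, hn'⟩ := U.nonempty_of_mem h1
    exact ⟨n, hn, fun s hs => Set.mem_iInter₂.1 hn' s hs⟩
  choose n hn hnG using hnext
  let next : Stage → Stage := fun p =>
    ⟨(p.1.1 ∪ (fun s => step s (n p)) '' p.1.1, n p), p.2.1.union (p.2.1.image _), by
      rintro s (hs | ⟨t, ht, rfl⟩)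
      · exact p.2.2 s hs
      · exact hstep t (p.2.2 t ht) _ (hnG p t ht)⟩
  let stage : ℕ → Stage := fun k => next^[k] ⟨({s₀}, 0), Set.finite_singleton _, by
    rintro s rfl
    exact hs₀⟩
  have hsucc : ∀ k, stage (k + 1) = next (stage k) := fun k =>
    Function.iterate_succ_apply' next k _
  refine ⟨fun k => n (stage k), fun k => (stage k).1.1, strictMono_nat_of_lt_succ fun k => ?_,
    rfl, fun k s hs => ⟨(stage k).2.2 s hs, hnG _ s hs, ?_, ?_⟩⟩
  · have := hn (stage (k + 1))
    rwa [show (stage (k + 1)).1.2 = n (stage k) by rw [hsucc]] at this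
  · change s ∈ (stage (k + 1)).1.1
    rw [hsucc]
    exact Or.inl hs
  · change _ ∈ (stage (k + 1)).1.1
    rw [hsucc]
    exact Or.inr ⟨s, hs, rfl⟩

variable {X : Type*}

/-- The set of points that remain after the moves `m 0, …, m (k - 1)`, starting from `S`: moves
alternately restrict to `C true n` and to `C false n`. -/
def alternatingRun (C : Bool → ℕ → Set X) : Set X → Bool → (ℕ → ℕ) → ℕ → Set X
  | S, _, _, 0 => S
  | S, c, m, k + 1 => alternatingRun C (S ∩ C c (m 0)) (!c) (fun i => m (i + 1)) k

/-- The position `(S, c)` is won if there is a strategy `σ`, which restricts moves to sets from the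
ultrafilter, such that all plays that respect it arrive at the empty set. -/
def IsWon (C : Bool → ℕ → Set X) (U : Ultrafilter ℕ) (S : Set X) (c : Bool) : Prop :=
  ∃ σ : List ℕ → Set ℕ, (∀ t, σ t ∈ U) ∧
    ∀ m : ℕ → ℕ, (∀ k, m k ∈ σ ((List.range k).map m)) → ∃ k, alternatingRun C S c m k = ∅

variable {C : Bool → ℕ → Set X} {U : Ultrafilter ℕ}

theorem isWon_of_eventually {S : Set X} {c : Bool}
    (h : {n | IsWon C U (S ∩ C c n) (!c)} ∈ U) : IsWon C U S c := by
  classical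
  choose! τ hτ hτ' using fun n (hn : n ∈ {n | IsWon C U (S ∩ C c n) (!c)}) => hn
  let σ : List ℕ → Set ℕ
    | [] => {n | IsWon C U (S ∩ C c n) (!c)}
    | n :: t => if IsWon C U (S ∩ C c n) (!c) then τ n t else Set.univ
  refine ⟨σ, ?_, fun m hm => ?_⟩
  · rintro (_ | ⟨n, t⟩)
    · exact h
    · by_cases hn : IsWon C U (S ∩ C c n) (!c)
      · simp only [σ, if_pos hn]
        exact hτ n hn t
      · simp only [σ, if_neg hn]
        exact univ_mem
  · have h0 : IsWon C U (S ∩ C c (m 0)) (!c) := hm 0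
    obtain ⟨k, hk⟩ := hτ' (m 0) h0 (fun i => m (i + 1)) fun k => by
      have := hm (k + 1)
      rw [List.range_succ_eq_map, List.map_cons, List.map_map] at this
      simp only [σ, if_pos h0] at this
      exact this
    exact ⟨k + 1, hk⟩

theorem isWon_empty {c : Bool} : IsWon C U ∅ c :=
  ⟨fun _ => Set.univ, fun _ => univ_mem, fun _ _ => ⟨0, rfl⟩⟩

theorem mem_alternatingRun {x : X} (k : ℕ) :
    ∀ {S : Set X} {c : Bool} {m : ℕ → ℕ}, x ∈ S →
      (∀ i, x ∈ C (if Even i then c else !c) (m i)) → x ∈ alternatingRun C S c m k := by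
  induction k with
  | zero => exact fun hx _ => hx
  | succ k ih =>
    intro S c m hx hm
    refine ih ⟨hx, by simpa using hm 0⟩ fun i => ?_
    have := hm (i + 1)
    by_cases hi : Even i <;> simpa [hi, Nat.even_add_one] using this

/-- If the alternating game is not won, some subsequence is independent. -/
theorem exists_independent_of_not_isWon (hU : (U : Filter ℕ) ≤ atTop)
    (h : ¬ IsWon C U Set.univ true) :
    ∃ e : ℕ → ℕ, StrictMono e ∧ ∀ P M : Finset ℕ, Disjoint P M →
      ∃ x, (∀ n ∈ P, x ∈ C true (e n)) ∧ ∀ n ∈ M, x ∈ C false (e n) := by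
  classical
  obtain ⟨e, Q, he, h0, hQ⟩ := exists_generic_sequence (α := Set X × Bool) U hU
    (fun s => {n | ¬ IsWon C U (s.1 ∩ C s.2 n) (!s.2)}) (fun s n => (s.1 ∩ C s.2 n, !s.2))
    (fun s => ¬ IsWon C U s.1 s.2)
    (fun s hs => Ultrafilter.compl_mem_iff_notMem.2 fun hs' => hs (isWon_of_eventually hs'))
    (fun s hs n hn => hn) (Set.univ, true) h
  -- in each block of three, the middle index is used for either colour: the first or the third
  -- one restores the alternation
  refine ⟨fun n => e (3 * n + 1), fun i j hij => he (by omega), fun P M hPM => ?_⟩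
  have key : ∀ n, ∃ S, (S, true) ∈ Q (3 * n) ∧ ∀ x ∈ S, ∀ i < n,
      (i ∈ P → x ∈ C true (e (3 * i + 1))) ∧ (i ∈ M → x ∈ C false (e (3 * i + 1))) := by
    intro n
    induction n with
    | zero => exact ⟨Set.univ, h0, fun x _ i hi => (Nat.not_lt_zero i hi).elim⟩
    | succ n ih =>
      obtain ⟨S, hS, hSx⟩ := ih
      by_cases hP : n ∈ P
      · have h1 := (hQ _ _ hS).2.2.1
        have h2 := (hQ _ _ h1).2.2.2
        have h3 := (hQ _ _ h2).2.2.2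
        refine ⟨_, h3, fun x hx i hi => ?_⟩
        rcases Nat.lt_succ_iff_lt_or_eq.1 hi with hi | rfl
        · exact hSx x hx.1.1 i hi
        · exact ⟨fun _ => hx.1.2, fun hM => (Finset.disjoint_left.1 hPM hP hM).elim⟩
      · by_cases hM : n ∈ M
        · have h1 := (hQ _ _ hS).2.2.2
          have h2 := (hQ _ _ h1).2.2.2
          have h3 := (hQ _ _ h2).2.2.1
          refine ⟨_, h3, fun x hx i hi => ?_⟩
          rcases Nat.lt_succ_iff_lt_or_eq.1 hi with hi | rfl
          · exact hSx x hx.1.1 i hi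
          · exact ⟨fun hP' => (hP hP').elim, fun _ => hx.2⟩
        · have h1 := (hQ _ _ hS).2.2.1
          have h2 := (hQ _ _ h1).2.2.1
          have h3 := (hQ _ _ h2).2.2.1
          refine ⟨_, h3, fun x hx i hi => ?_⟩
          rcases Nat.lt_succ_iff_lt_or_eq.1 hi with hi | rfl
          · exact hSx x hx i hi
          · exact ⟨fun hP' => (hP hP').elim, fun hM' => (hM hM').elim⟩
  obtain ⟨N, hN⟩ := (P ∪ M).exists_nat_subset_range
  obtain ⟨S, hS, hSx⟩ := key N
  obtain ⟨x, hx⟩ : S.Nonempty := by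
    by_contra hne
    rw [Set.not_nonempty_iff_eq_empty] at hne
    subst hne
    exact (hQ _ _ hS).1 isWon_empty
  refine ⟨x, fun n hn => (hSx x hx n ?_).1 hn, fun n hn => (hSx x hx n ?_).2 hn⟩
  · exact Finset.mem_range.1 (hN (Finset.mem_union_left _ hn))
  · exact Finset.mem_range.1 (hN (Finset.mem_union_right _ hn))

/-- If the alternating game is won, then along some subsequence no point lies infinitely often in
the sets of both colours: such a point would provide a play that respects the strategy. -/
theorem exists_not_frequently_of_isWon (hU : (U : Filter ℕ) ≤ atTop)
    (h : IsWon C U Set.univ true) :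
    ∃ e : ℕ → ℕ, StrictMono e ∧ ∀ x, ¬ ((∃ᶠ n in atTop, x ∈ C true (e n)) ∧
      ∃ᶠ n in atTop, x ∈ C false (e n)) := by
  obtain ⟨σ, hσ, hwin⟩ := h
  obtain ⟨e, Q, he, h0, hQ⟩ := exists_generic_sequence (α := List ℕ) U hU σ
    (fun t n => t ++ [n]) (fun _ => True) (fun t _ => hσ t) (fun _ _ _ _ => trivial) [] trivial
  refine ⟨e, he, fun x hx => ?_⟩
  obtain ⟨j, hj, hjx⟩ := extraction_forall_of_frequently
    (P := fun n k => x ∈ C (if Even n then true else !true) (e k)) fun n => by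
      by_cases hn : Even n
      · simpa [hn] using hx.1
      · simpa [hn] using hx.2
  have hQmono : ∀ k l, k ≤ l → Q k ⊆ Q l := fun k l hkl =>
    monotone_nat_of_le_succ (f := Q) (fun k s hs => (hQ k s hs).2.2.1) hkl
  have hplay : ∀ k, (List.range k).map (fun i => e (j i)) ∈ Q (j k) := by
    intro k
    induction k with
    | zero => exact hQmono 0 _ (Nat.zero_le _) h0
    | succ k ih =>
      rw [List.range_succ, List.map_append]
      exact hQmono (j k + 1) _ (hj k.lt_succ_self) (hQ _ _ ih).2.2.2
  obtain ⟨k, hk⟩ := hwin (fun i => e (j i)) fun k => (hQ _ _ (hplay k)).2.1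
  have := mem_alternatingRun k (C := C) (c := true) (Set.mem_univ x) hjx
  rw [hk] at this
  exact this

/-- Rosenthal's dichotomy: a bounded sequence of functions without independent subsequences has a
pointwise convergent subsequence. -/
theorem exists_subseq_tendsto_of_not_independent {f : ℕ → X → ℝ} {R : ℝ}
    (hR : ∀ n x, |f n x| ≤ R)
    (hf : ∀ e : ℕ → ℕ, StrictMono e → ¬ IsIndependentSeq fun n => f (e n)) :
    ∃ e : ℕ → ℕ, StrictMono e ∧ ∀ x, ∃ c, Tendsto (fun n => f (e n) x) atTop (𝓝 c) := by
  -- for one pair of levels `a < b`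
  have hpair : ∀ (e : {e : ℕ → ℕ // StrictMono e}) (a b : ℝ), a < b →
      ∃ k : ℕ → ℕ, StrictMono k ∧ ∀ x, ¬ ((∃ᶠ n in atTop, f (e.1 (k n)) x < a) ∧
        ∃ᶠ n in atTop, b < f (e.1 (k n)) x) := by
    intro e a b hab
    let C : Bool → ℕ → Set X := fun c n =>
      if c then {x | f (e.1 n) x < a} else {x | b < f (e.1 n) x}
    by_cases hwon : IsWon C (hyperfilter ℕ) Set.univ true
    · exact exists_not_frequently_of_isWon Nat.hyperfilter_le_atTop hwon
    · obtain ⟨k, hk, hind⟩ := exists_independent_of_not_isWon Nat.hyperfilter_le_atTop hwon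
      exact (hf _ (e.2.comp hk) ⟨a, b, hab, hind⟩).elim
  have : Nonempty {p : ℚ × ℚ // p.1 < p.2} := ⟨⟨(0, 1), zero_lt_one⟩⟩
  obtain ⟨q, hq⟩ := exists_surjective_nat {p : ℚ × ℚ // p.1 < p.2}
  choose k hk hkx using fun (e : {e : ℕ → ℕ // StrictMono e}) (i : ℕ) =>
    hpair e (q i).1.1 (q i).1.2 (by exact_mod_cast (q i).2)
  -- successive subsequences for all rational pairs
  let E : ℕ → {e : ℕ → ℕ // StrictMono e} := fun i => i.rec ⟨id, strictMono_id⟩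
    fun i e => ⟨e.1 ∘ k e i, e.2.comp (hk e i)⟩
  have hE : ∀ i, (E (i + 1)).1 = (E i).1 ∘ k (E i) i := fun i => rfl
  let L : ℕ → Filter ℕ := fun i => map (E i).1 atTop
  have hLanti : Antitone L := antitone_nat_of_succ_le fun i => by
    change map (E (i + 1)).1 atTop ≤ _
    rw [hE, ← map_map]
    exact map_mono (hk (E i) i).tendsto_atTop
  have hLne : (⨅ i, L i).NeBot := iInf_neBot_of_directed' hLanti.directed_ge fun i => inferInstance
  obtain ⟨u, hu⟩ := exists_seq_tendsto (⨅ i, L i)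
  have hu0 : Tendsto u atTop atTop := hu.mono_right ((iInf_le L 0).trans (map_id).le)
  obtain ⟨v, hv, huv⟩ := strictMono_subseq_of_tendsto_atTop hu0
  refine ⟨u ∘ v, huv, fun x => ?_⟩
  refine tendsto_of_no_upcrossings (s := Set.range ((↑) : ℚ → ℝ)) Rat.denseRange_cast ?_ ?_ ?_
  · rintro _ ⟨a, rfl⟩ _ ⟨b, rfl⟩ hab ⟨h1, h2⟩
    obtain ⟨i, hi⟩ := hq ⟨(a, b), by exact_mod_cast hab⟩
    have hLi : Tendsto (u ∘ v) atTop (map ((E i).1 ∘ k (E i) i) atTop) :=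
      (hu.comp hv.tendsto_atTop).mono_right (iInf_le L (i + 1))
    refine hkx (E i) i x ⟨?_, ?_⟩
    · rw [hi]
      exact frequently_map.1 (hLi.frequently (p := fun n => f n x < a) h1)
    · rw [hi]
      exact frequently_map.1 (hLi.frequently (p := fun n => (b : ℝ) < f n x) h2)
  · exact isBoundedUnder_of ⟨R, fun n => (abs_le.1 (hR _ x)).2⟩
  · exact isBoundedUnder_of ⟨-R, fun n => (abs_le.1 (hR _ x)).1⟩

end Rosenthal

section Tame

theorem comp_mem_tameClass (K₁ K₂ : Type u) [TopologicalSpace K₁] [CompactSpace K₁] [T2Space K₁]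
    [TopologicalSpace K₂] [CompactSpace K₂] [T2Space K₂] (p : C(K₁, K₂)) (A : Set C(K₂, ℝ))
    (hA : A ∈ tameClass K₂) : (fun f : C(K₂, ℝ) => f.comp p) '' A ∈ tameClass K₁ := by
  refine ⟨isBounded_image_comp p hA.1, fun f hf hind => ?_⟩
  choose g hg hgf using hf
  obtain rfl : (fun n => (g n).comp p) = f := funext hgf
  obtain ⟨a, b, hab, h⟩ := hind
  refine hA.2 g hg ⟨a, b, hab, fun P M hPM => ?_⟩
  obtain ⟨x, hx⟩ := h P M hPM
  exact ⟨p x, hx⟩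

theorem mem_tameClass_of_comp (K₁ K₂ : Type u) [TopologicalSpace K₁] [CompactSpace K₁]
    [T2Space K₁] [TopologicalSpace K₂] [CompactSpace K₂] [T2Space K₂] (p : C(K₁, K₂))
    (A : Set C(K₂, ℝ)) (hp : Function.Surjective p)
    (hA : (fun f : C(K₂, ℝ) => f.comp p) '' A ∈ tameClass K₁) : A ∈ tameClass K₂ := by
  refine ⟨isBounded_of_image_comp p hp hA.1, fun f hf hind => ?_⟩
  obtain ⟨a, b, hab, h⟩ := hind
  refine hA.2 (fun n => (f n).comp p) (fun n => ⟨f n, hf n, rfl⟩) ⟨a, b, hab, fun P M hPM => ?_⟩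
  obtain ⟨x, hx⟩ := h P M hPM
  obtain ⟨y, rfl⟩ := hp x
  exact ⟨y, hx⟩

/-- An independent sequence of continuous functions on a compact space has no pointwise convergent
subsequence. -/
theorem not_isIndependentSeq_of_tendsto {X : Type*} [TopologicalSpace X] [CompactSpace X]
    {f : ℕ → C(X, ℝ)} {e : ℕ → ℕ} (he : StrictMono e)
    (h : ∀ x, ∃ c, Tendsto (fun n => f (e n) x) atTop (𝓝 c)) :
    ¬ IsIndependentSeq fun n => (f n : X → ℝ) := by
  classical
  rintro ⟨a, b, hab, hind⟩
  -- a point at which even terms stay below `a` and odd terms stay above `b`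
  let T : ℕ → Set X := fun N => {x | ∀ n < N, f (e (2 * n)) x ≤ a ∧ b ≤ f (e (2 * n + 1)) x}
  have hTc : ∀ N, IsClosed (T N) := fun N => by
    simp only [T, Set.ofPred_forall]
    refine isClosed_iInter fun n => isClosed_iInter fun _ => ?_
    exact (isClosed_le (f _).continuous continuous_const).inter
      (isClosed_le continuous_const (f _).continuous)
  have hTne : ∀ N, (T N).Nonempty := fun N => by
    obtain ⟨x, hx1, hx2⟩ := hind ((Finset.range N).image fun n => e (2 * n))
      ((Finset.range N).image fun n => e (2 * n + 1)) (by
        refine Finset.disjoint_left.2 fun i hi hi' => ?_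
        obtain ⟨m, -, rfl⟩ := Finset.mem_image.1 hi
        obtain ⟨n, -, hn⟩ := Finset.mem_image.1 hi'
        have := he.injective hn
        omega)
    exact ⟨x, fun n hn => ⟨(hx1 _ (Finset.mem_image.2 ⟨n, Finset.mem_range.2 hn, rfl⟩)).le,
      (hx2 _ (Finset.mem_image.2 ⟨n, Finset.mem_range.2 hn, rfl⟩)).le⟩⟩
  obtain ⟨x, hx⟩ := IsCompact.nonempty_iInter_of_sequence_nonempty_isCompact_isClosed T
    (fun N x hx n hn => hx n (hn.trans N.lt_succ_self)) hTne (hTc 0).isCompact hTc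
  obtain ⟨c, hc⟩ := h x
  have hxn : ∀ n, f (e (2 * n)) x ≤ a ∧ b ≤ f (e (2 * n + 1)) x := fun n =>
    Set.mem_iInter.1 hx (n + 1) n n.lt_succ_self
  have h1 : c ≤ a := le_of_tendsto' (hc.comp (tendsto_id.const_mul_atTop' two_pos))
    fun n => (hxn n).1
  have h2 : b ≤ c := ge_of_tendsto' (hc.comp (tendsto_atTop_mono (fun n => by
    change n ≤ 2 * n + 1
    omega) tendsto_id : Tendsto (fun n => 2 * n + 1) atTop atTop)) fun n => (hxn n).2
  linarith

/-- By Rosenthal's dichotomy and dominated convergence, sequences in a tame family have weakly Cauchy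
subsequences, so that they are not independent on the dual ball. -/
theorem isPolarlyCompatible_tameClass : IsPolarlyCompatible tameClass.{u} := by
  intro K _ _ _ A hA
  refine ⟨isBounded_image_restr_dualBall hA.1, fun f hf => ?_⟩
  choose g hg hgf using hf
  obtain rfl : (fun n => restr (dualBall C(K, ℝ)) (g n)) = f := funext hgf
  obtain ⟨R, hR⟩ := isBounded_iff_pointwise.1 hA.1
  obtain ⟨e, he, hconv⟩ := exists_subseq_tendsto_of_not_independent
    (f := fun n => (g n : K → ℝ)) (fun n x => hR _ (hg n) x)
    fun e _ => hA.2 (fun n => g (e n)) fun n => hg _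
  choose l hl using hconv
  refine not_isIndependentSeq_of_tendsto he fun ν => ?_
  obtain ⟨c, hc, -⟩ := exists_tendsto_apply_of_tendsto_pointwise (WeakDual.toStrongDual ν.1)
    (fun n x => hR _ (hg (e n)) x) hl
  exact ⟨c, hc⟩

end Tame

/-! ### Co-small functionals and co-small functions -/

theorem corollary4 {G : Type u} [Group G] [TopologicalSpace G] [IsTopologicalGroup G]
    [LocallyCompactSpace G] [T2Space G] [MeasurableSpace G] [BorelSpace G]
    (μ : Measure G) [μ.IsHaarMeasure] [μ.Regular] :
    (∀ 𝔅 : FamilyClass.{u}, IsBornologicalClass 𝔅 → IsPolarlyCompatible 𝔅 →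
      coSmallFunctionals (l1Conv μ) 𝔅 = coSmallFunctions μ 𝔅) ∧
    coSmallFunctionals (l1Conv μ) dlpClass = coSmallFunctions μ dlpClass ∧
    coSmallFunctionals (l1Conv μ) npClass = coSmallFunctions μ npClass ∧
    coSmallFunctionals (l1Conv μ) tameClass = coSmallFunctions μ tameClass :=
  ⟨fun _ h𝔅 hpol => coSmallFunctionals_eq_coSmallFunctions μ h𝔅.comp h𝔅.of_comp hpol,
    coSmallFunctionals_eq_coSmallFunctions μ comp_mem_dlpClass mem_dlpClass_of_comp
      isPolarlyCompatible_dlpClass,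
    coSmallFunctionals_eq_coSmallFunctions μ comp_mem_npClass mem_npClass_of_comp
      isPolarlyCompatible_npClass,
    coSmallFunctionals_eq_coSmallFunctions μ comp_mem_tameClass mem_tameClass_of_comp
      isPolarlyCompatible_tameClass⟩
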